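/- All vector spaces are real, $\mathbb N=\{0,1,2,\dots\}$, and $\mathrm{HLCV}$ denotes the class of Hausdorff locally convex topological vector spaces. **Definitions.** Let $H,F\in\mathrm{HLCV}$ and $k\in\mathbb N\cup\{\infty\}$. For $U\subseteq H$ open and $f\colon U\to F$, put $D_vf(x)=\lim_{t\to0}\frac1t\,(f(x+tv)-f(x))$ and $\mathrm d^\ell f(x,v_1,\dots,v_\ell)=D_{v_\ell}(\cdots(D_{v_1}f)\cdots)(x)$, with $\mathrm d^0f=f$. The map $f$ is of class $C^k$ (in Bastiani's sense) if for all natural numbers $\ell\le k$ the iterated derivatives $\mathrm d^\ell f$ exist on all of $U\times H^\ell$ and $\mathrm d^\ell f\colon U\times H^\ell\to F$ is continuous. Let $\Omega(H)$ be the set of pairs $(U,\breve U)$ with $U\subseteq H$ nonempty open and $U\subseteq\breve U\subseteq\overline U$. Let $\mathcal C^k_{\breve U}(U,F)$ be the vector space of all $C^k$-maps $f\colon U\to F$ such that for every natural number $\ell\le k$ the map $\mathrm d^\ell f$ extends to a (necessarily unique) continuous map $\mathrm{ext}(f,\ell)\colon\breve U\times H^\ell\to F$. For $E\in\mathrm{HLCV}$,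 $(V,\breve V)\in\Omega(E)$ and $-\infty\le a<b\le\infty$ write $\mathcal C^k_{\breve V}((a,b)\times V,F):=\mathcal C^k_{(a,b]\times\breve V}((a,b)\times V,F)$, where $(a,b]:=(a,\infty)$ if $b=\infty$; here $H=\mathbb R\times E$. For a continuous seminorm $\mathfrak p$ on $F$, a compact set $K\subseteq(a,b]\times\breve V$, a bounded set $\mathcal B\subseteq\mathbb R\times E$ and a natural number $d\le k$, put $$\mathfrak p^{d}_{K\times\mathcal B}(f)=\max_{0\le\ell\le d}\ \sup\{\mathfrak p(\mathrm{ext}(f,\ell)(z,\underline w)) : z\in K,\ \underline w\in\mathcal B^\ell\},$$ and write $\mathfrak p^0_K(f)=\sup\{\mathfrak p(\mathrm{ext}(f,0)(z)) : z\in K\}$. For $B\subseteq E$ put $\mathfrak B(B)=\{(1,0)\}\cup(\{0\}\times B)\subseteq\mathbb R\times E$. **Theorem.** Let $F\in\mathrm{HLCV}$, $k\in\mathbb N\cup\{\infty\}$ and $-\infty\le a<\tau<b<\infty$ be fixed. There exist linear maps $$\mathcal E(E,V,\breve V)\colon\mathcal C^k_{\breve V}((a,b)\times V,F)\to\mathcal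 C^k_{\breve V}((a,\infty)\times V,F)\qquad(E\in\mathrm{HLCV},\ (V,\breve V)\in\Omega(E))$$ with the following properties; we abbreviate $\mathcal E f=\mathcal E(E,V,\breve V)(f)$. 1. For all $E$, $(V,\breve V)\in\Omega(E)$, $f\in\mathcal C^k_{\breve V}((a,b)\times V,F)$ and all natural numbers $\ell\le k$: $\mathrm{ext}(\mathcal Ef,\ell)=\mathrm{ext}(f,\ell)$ on $(a,b]\times\breve V\times(\mathbb R\times E)^\ell$, and $\mathrm{ext}(\mathcal Ef,\ell)=0$ on $[2b-\tau,\infty)\times\breve V\times(\mathbb R\times E)^\ell$. 2. There are constants $C_d\in[1,\infty)$, one for each natural number $d\le k$, such that for all $E$, $(V,\breve V)\in\Omega(E)$, $t\in(b,\infty)$, $x\in\breve V$, all continuous seminorms $\mathfrak p$ on $F$ and all $f\in\mathcal C^k_{\breve V}((a,b)\times V,F)$: * $\mathfrak p(\mathrm{ext}(\mathcal Ef,0)(t,x))\le C_0\cdot\mathfrak p^0_{[\tau,b]\times\{x\}}(f)$; * for all natural numbers $1\le\ell\le d\le k$, all bounded $B\subseteq E$ and all $\underline w=((\lambda_1,X_1),\dots,(\lambda_\ell,X_\ell))\in(\mathbb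 R\times B)^\ell$, $$\mathfrak p(\mathrm{ext}(\mathcal Ef,\ell)((t,x),\underline w))\le C_d\cdot\max(1,|\lambda_1|,\dots,|\lambda_\ell|)^\ell\cdot\mathfrak p^d_{[\tau,b]\times\{x\}\times\mathfrak B(B)}(f).$$ The right-hand sides of both estimates are finite. 3. Let $E,\bar E\in\mathrm{HLCV}$, let $\mathcal W\subseteq E$ be a linear subspace, $\Upsilon\colon\mathcal W\to\bar E$ a linear map (not assumed continuous), $(V,\breve V)\in\Omega(E)$, $(\bar V,\breve{\bar V})\in\Omega(\bar E)$, $f\in\mathcal C^k_{\breve V}((a,b)\times V,F)$, $\bar f\in\mathcal C^k_{\breve{\bar V}}((a,b)\times\bar V,F)$, $x\in\breve V$, $\bar x\in\breve{\bar V}$, and let $d\le k$ be a natural number. If $$\mathrm{ext}(f,\ell)\big((t,x),(\lambda_i,X_i)_{i\le\ell}\big)=\mathrm{ext}(\bar f,\ell)\big((t,\bar x),(\lambda_i,\Upsilon(X_i))_{i\le\ell}\big)$$ for all $0\le\ell\le d$, $t\in[\tau,b]$, $\lambda_i\in\mathbb R$, $X_i\in\mathcal W$, then $$\mathrm{ext}(\mathcal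 Ef,d)\big((t,x),(\lambda_i,X_i)_{i\le d}\big)=\mathrm{ext}(\mathcal E\bar f,d)\big((t,\bar x),(\lambda_i,\Upsilon(X_i))_{i\le d}\big)$$ for all $t\in[\tau,\infty)$, $\lambda_i\in\mathbb R$, $X_i\in\mathcal W$. -/

import Mathlib

open Filter Topology Set
open scoped ENNReal

universe u v

/-! ### Bastiani's differential calculus -/

section Bastiani

set_option linter.unusedSectionVars false

variable {H : Type*} [AddCommGroup H] [Module ℝ H] [TopologicalSpace H]
variable {F : Type*} [AddCommGroup F] [Module ℝ F] [TopologicalSpace F]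

/-- `y` is the directional derivative of `g` at `x` in direction `v`, i.e. the limit of
`t⁻¹ • (g (x + t • v) - g x)` as `t → 0`, `t ≠ 0`. -/
def HasDirDeriv (g : H → F) (y : F) (x v : H) : Prop :=
  Tendsto (fun t : ℝ => t⁻¹ • (g (x + t • v) - g x)) (𝓝[≠] 0) (𝓝 y)

/-- The directional derivative `D_v g (x)` (meaningful where the limit exists). -/
noncomputable def dirDeriv (g : H → F) (x v : H) : F :=
  limUnder (𝓝[≠] (0 : ℝ)) (fun t : ℝ => t⁻¹ • (g (x + t • v) - g x))

/-- The iterated differential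
`dᵖ g (x, w₁, …, w_p) = D_{w_p} (D_{w_{p-1}} (⋯ (D_{w₁} g) ⋯)) (x)`. It depends only on `g` in a
neighbourhood of `x`. -/
noncomputable def iterDiff (g : H → F) : (p : ℕ) → H → (Fin p → H) → F
  | 0, x, _ => g x
  | p + 1, x, w =>
      dirDeriv (fun y => iterDiff g p y (fun i => w i.castSucc)) x (w (Fin.last p))

/-- `g` is of class `C^k` on the open set `U` in Bastiani's sense: all iterated directional
derivatives of order at most `k` exist on `U`, and `dᵖ g : U × Hᵖ → F` is continuous for all
natural numbers `p ≤ k`. -/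
def IsCk (k : ℕ∞) (U : Set H) (g : H → F) : Prop :=
  (∀ p : ℕ, ((p + 1 : ℕ) : ℕ∞) ≤ k → ∀ (w : Fin p → H), ∀ x ∈ U, ∀ v : H,
      ∃ y : F, HasDirDeriv (fun z => iterDiff g p z w) y x v) ∧
  (∀ p : ℕ, (p : ℕ∞) ≤ k →
      ContinuousOn (fun q : H × (Fin p → H) => iterDiff g p q.1 q.2) (U ×ˢ univ))

/-- The map on the whole space that agrees with `f : U → F` on `U` and is `0` elsewhere. -/
noncomputable def zeroExt {U : Set H} (f : U → F) : H → F :=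
  Function.extend Subtype.val f 0

/-- The set `Ω(H)` of pairs `(V, V̆)` with `V ⊆ H` nonempty open and `V ⊆ V̆ ⊆ closure V`. -/
structure Omega (H : Type*) [TopologicalSpace H] where
  /-- the nonempty open set `V` -/
  inner : Set H
  /-- the set `V̆` between `V` and its closure -/
  outer : Set H
  isOpen_inner : IsOpen inner
  nonempty_inner : inner.Nonempty
  inner_subset_outer : inner ⊆ outer
  outer_subset_closure : outer ⊆ closure inner

/-- The extended differential `ext(f, ℓ) : V̆ × H^ℓ → F`, i.e. the extension by continuity of
`d^ℓ f : V × H^ℓ → F`. -/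
noncomputable def extDiff (P : Omega H) (f : P.inner → F) (ℓ : ℕ) (z : H) (w : Fin ℓ → H) : F :=
  extendFrom (P.inner ×ˢ (univ : Set (Fin ℓ → H)))
    (fun q : H × (Fin ℓ → H) => iterDiff (zeroExt f) ℓ q.1 q.2) (z, w)

/-- `f : V → F` is of class `C^k`, and for every natural number `ℓ ≤ k` its `ℓ`-th differential
extends to a continuous map `V̆ × H^ℓ → F`. -/
def IsCkExt (k : ℕ∞) (P : Omega H) (f : P.inner → F) : Prop :=
  IsCk k P.inner (zeroExt f) ∧
  ∀ ℓ : ℕ, (ℓ : ℕ∞) ≤ k → ∃ Φ : H × (Fin ℓ → H) → F,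
    ContinuousOn Φ (P.outer ×ˢ univ) ∧
    ∀ z ∈ P.inner, ∀ w : Fin ℓ → H, Φ (z, w) = iterDiff (zeroExt f) ℓ z w

/-- Any continuous extension of the `ℓ`-th differential to `V̆ × H^ℓ` is given by `extDiff`. -/
theorem extDiff_eq_of_continuousOn [T2Space F] (P : Omega H) (f : P.inner → F) (ℓ : ℕ)
    (Φ : H × (Fin ℓ → H) → F) (hc : ContinuousOn Φ (P.outer ×ˢ univ))
    (hΦ : ∀ z ∈ P.inner, ∀ w : Fin ℓ → H, Φ (z, w) = iterDiff (zeroExt f) ℓ z w)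
    {z : H} (hz : z ∈ P.outer) (w : Fin ℓ → H) : extDiff P f ℓ z w = Φ (z, w) := by
  refine extendFrom_eq ?_ ?_
  · rw [closure_prod_eq]
    exact ⟨P.outer_subset_closure hz, by simp⟩
  · have h1 : Tendsto Φ (𝓝[P.inner ×ˢ univ] (z, w)) (𝓝 (Φ (z, w))) :=
      (hc (z, w) ⟨hz, mem_univ _⟩).mono (prod_mono P.inner_subset_outer subset_rfl)
    refine h1.congr' ?_
    filter_upwards [self_mem_nhdsWithin] with q hq
    exact hΦ q.1 hq.1 q.2

theorem zeroExt_smul_add {U : Set H} (c : ℝ) (f g : U → F) :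
    zeroExt (c • f + g) = c • zeroExt f + zeroExt g := by
  funext x
  by_cases hx : x ∈ U
  · have h (e : U → F) : zeroExt e x = e ⟨x, hx⟩ :=
      Subtype.val_injective.extend_apply e 0 ⟨x, hx⟩
    simp [h]
  · have h (e : U → F) : zeroExt e x = 0 :=
      Function.extend_apply' e (0 : H → F) x (fun ⟨y, hy⟩ => hx (hy ▸ y.2))
    simp [h]

theorem hasDirDeriv_dirDeriv [T2Space F] {g : H → F} {x v : H}
    (h : ∃ y, HasDirDeriv g y x v) : HasDirDeriv g (dirDeriv g x v) x v :=
  tendsto_nhds_limUnder h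

theorem HasDirDeriv.dirDeriv_eq [T2Space F] {g : H → F} {x v : H} {y : F}
    (h : HasDirDeriv g y x v) : dirDeriv g x v = y :=
  Tendsto.limUnder_eq h

theorem hasDirDeriv_smul_add [ContinuousAdd H] [ContinuousSMul ℝ H]
    [ContinuousAdd F] [ContinuousConstSMul ℝ F]
    {U : Set H} (hU : IsOpen U) {g h e : H → F} {c : ℝ} (he : ∀ z ∈ U, e z = c • g z + h z)
    {x v : H} (hx : x ∈ U) {y y' : F} (hg : HasDirDeriv g y x v) (hh : HasDirDeriv h y' x v) :
    HasDirDeriv e (c • y + y') x v := by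
  have h1 : Tendsto (fun t : ℝ => x + t • v) (𝓝[≠] 0) (𝓝 x) := by
    have : Continuous (fun t : ℝ => x + t • v) := by fun_prop
    have h2 := this.tendsto 0
    simp only [zero_smul, add_zero] at h2
    exact h2.mono_left nhdsWithin_le_nhds
  refine ((hg.const_smul c).add hh).congr' ?_
  filter_upwards [h1 (hU.mem_nhds hx)] with t ht
  rw [he _ ht, he _ hx]
  module

theorem iterDiff_smul_add [ContinuousAdd H] [ContinuousSMul ℝ H]
    [ContinuousAdd F] [ContinuousConstSMul ℝ F] [T2Space F]
    {k : ℕ∞} {U : Set H} (hU : IsOpen U) {g h : H → F} (hg : IsCk k U g) (hh : IsCk k U h)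
    (c : ℝ) (p : ℕ) : (p : ℕ∞) ≤ k → ∀ x ∈ U, ∀ w : Fin p → H,
      iterDiff (c • g + h) p x w = c • iterDiff g p x w + iterDiff h p x w := by
  induction p with
  | zero => intro _ x _ w; simp [iterDiff]
  | succ p ih =>
    intro hp x hx w
    have hp' : (p : ℕ∞) ≤ k := le_trans (by exact_mod_cast Nat.le_succ p) hp
    exact (hasDirDeriv_smul_add hU (fun z hz => ih hp' z hz _) hx
      (hasDirDeriv_dirDeriv (hg.1 p hp _ x hx _))
      (hasDirDeriv_dirDeriv (hh.1 p hp _ x hx _))).dirDeriv_eq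

theorem isCkExt_smul_add [ContinuousAdd H] [ContinuousSMul ℝ H]
    [ContinuousAdd F] [ContinuousConstSMul ℝ F] [T2Space F]
    {k : ℕ∞} {P : Omega H} {f g : P.inner → F} (hf : IsCkExt k P f) (hg : IsCkExt k P g)
    (c : ℝ) : IsCkExt k P (c • f + g) := by
  have key := fun p hp => iterDiff_smul_add P.isOpen_inner hf.1 hg.1 c p hp
  refine ⟨⟨?_, ?_⟩, ?_⟩
  · intro p hp w x hx v
    have hp' : (p : ℕ∞) ≤ k := le_trans (by exact_mod_cast Nat.le_succ p) hp
    obtain ⟨y, hy⟩ := hf.1.1 p hp w x hx v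
    obtain ⟨y', hy'⟩ := hg.1.1 p hp w x hx v
    rw [zeroExt_smul_add]
    exact ⟨_, hasDirDeriv_smul_add P.isOpen_inner (fun z hz => key p hp' z hz w) hx hy hy'⟩
  · intro p hp
    rw [zeroExt_smul_add]
    refine (((hf.1.2 p hp).const_smul c).add (hg.1.2 p hp)).congr ?_
    intro q hq
    exact key p hp q.1 hq.1 q.2
  · intro ℓ hℓ
    obtain ⟨Φ, hΦ, hΦ'⟩ := hf.2 ℓ hℓ
    obtain ⟨Ψ, hΨ, hΨ'⟩ := hg.2 ℓ hℓ
    refine ⟨fun q => c • Φ q + Ψ q, (hΦ.const_smul c).add hΨ, ?_⟩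
    intro z hz w
    change c • Φ (z, w) + Ψ (z, w) = _
    rw [zeroExt_smul_add, key ℓ hℓ z hz w, hΦ' z hz w, hΨ' z hz w]

theorem iterDiff_zero [T2Space F] (p : ℕ) : ∀ (x : H) (w : Fin p → H),
    iterDiff (0 : H → F) p x w = 0 := by
  induction p with
  | zero => intro x w; rfl
  | succ p ih =>
    intro x w
    refine HasDirDeriv.dirDeriv_eq ?_
    simp only [HasDirDeriv, ih, sub_self, smul_zero]
    exact tendsto_const_nhds

theorem isCkExt_zero [T2Space F] (k : ℕ∞) (P : Omega H) :
    IsCkExt k P (0 : P.inner → F) := by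
  have h0 : zeroExt (0 : P.inner → F) = 0 := by
    funext x
    by_cases hx : x ∈ P.inner
    · exact Subtype.val_injective.extend_apply (0 : P.inner → F) 0 ⟨x, hx⟩
    · exact Function.extend_apply' (0 : P.inner → F) (0 : H → F) x (fun ⟨y, hy⟩ => hx (hy ▸ y.2))
  refine ⟨⟨?_, ?_⟩, ?_⟩
  · intro p _ w x _ v
    refine ⟨0, ?_⟩
    simp only [HasDirDeriv, h0, iterDiff_zero, sub_self, smul_zero]
    exact tendsto_const_nhds
  · intro p _
    simp only [h0, iterDiff_zero]
    exact continuousOn_const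
  · intro ℓ _
    refine ⟨fun _ => 0, continuousOn_const, ?_⟩
    intro z _ w
    rw [h0, iterDiff_zero]

/-- The real vector space `C^k_{V̆}(V, F)` of all `C^k`-maps `f : V → F` whose `ℓ`-th differentials,
for `ℓ ≤ k`, extend continuously to `V̆ × H^ℓ`. -/
def CkSpace [ContinuousAdd H] [ContinuousSMul ℝ H] (k : ℕ∞) (P : Omega H)
    (F : Type*) [AddCommGroup F] [Module ℝ F] [TopologicalSpace F]
    [ContinuousAdd F] [ContinuousConstSMul ℝ F] [T2Space F] :
    Submodule ℝ (P.inner → F) where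
  carrier := {f | IsCkExt k P f}
  zero_mem' := isCkExt_zero k P
  add_mem' := by
    intro f g hf hg
    have := isCkExt_smul_add hf hg 1
    rwa [one_smul] at this
  smul_mem' := by
    intro c f hf
    have := isCkExt_smul_add hf (isCkExt_zero k P) c
    rwa [add_zero] at this

/-- `sup { p (ext(f, ℓ)(z, w)) | z ∈ K, w ∈ B^ℓ }`, as an extended nonnegative real. -/
noncomputable def supSeminorm (p : Seminorm ℝ F) (P : Omega H) (f : P.inner → F)
    (K B : Set H) (ℓ : ℕ) : ℝ≥0∞ :=
  ⨆ z ∈ K, ⨆ w ∈ {w : Fin ℓ → H | ∀ i, w i ∈ B}, ENNReal.ofReal (p (extDiff P f ℓ z w))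

/-- The maximum of the suprema `supSeminorm` over the orders `0 ≤ ℓ ≤ d`. -/
noncomputable def maxSeminorm (p : Seminorm ℝ F) (P : Omega H) (f : P.inner → F)
    (K B : Set H) (d : ℕ) : ℝ≥0∞ :=
  ⨆ ℓ ∈ Finset.range (d + 1), supSeminorm p P f K B ℓ

end Bastiani

/-! ### The domains `(a, b) × V` -/

/-- The interval `(a, b)` of real numbers, for extended real `a, b`. -/
def openInterval (a b : EReal) : Set ℝ := {t | a < (t : EReal) ∧ (t : EReal) < b}

/-- The interval `(a, b]` of real numbers, for extended real `a, b`; it is `(a, ∞)` for `b = ∞`. -/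
def halfOpenInterval (a b : EReal) : Set ℝ := {t | a < (t : EReal) ∧ (t : EReal) ≤ b}

theorem halfOpenInterval_subset_closure {a b : EReal} :
    halfOpenInterval a b ⊆ closure (openInterval a b) := by
  rintro t ⟨h1, h2⟩
  obtain ⟨c, hc1, hc2⟩ := EReal.lt_iff_exists_real_btwn.1 h1
  have hct : c < t := by exact_mod_cast hc2
  have hsub : Ioo c t ⊆ openInterval a b := fun s hs =>
    ⟨hc1.trans (EReal.coe_lt_coe_iff.2 hs.1), (EReal.coe_lt_coe_iff.2 hs.2).trans_le h2⟩
  apply closure_mono hsub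
  rw [closure_Ioo hct.ne]
  exact ⟨hct.le, le_rfl⟩

/-- For `(V, V̆) ∈ Ω(E)` and `-∞ ≤ a < b ≤ ∞`, the pair `((a, b) × V, (a, b] × V̆) ∈ Ω(ℝ × E)`. -/
def Omega.slab {E : Type*} [TopologicalSpace E] (P : Omega E) (a b : EReal) (hab : a < b) :
    Omega (ℝ × E) where
  inner := openInterval a b ×ˢ P.inner
  outer := halfOpenInterval a b ×ˢ P.outer
  isOpen_inner :=
    ((isOpen_lt continuous_const continuous_coe_real_ereal).inter
      (isOpen_lt continuous_coe_real_ereal continuous_const)).prod P.isOpen_inner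
  nonempty_inner := by
    obtain ⟨c, hc1, hc2⟩ := EReal.lt_iff_exists_real_btwn.1 hab
    exact Set.Nonempty.prod ⟨c, hc1, hc2⟩ P.nonempty_inner
  inner_subset_outer :=
    prod_mono (fun _ ht => ⟨ht.1, ht.2.le⟩) P.inner_subset_outer
  outer_subset_closure := by
    rw [closure_prod_eq]
    exact prod_mono halfOpenInterval_subset_closure P.outer_subset_closure

/-- For `B ⊆ E`, the set `{(1, 0)} ∪ ({0} × B) ⊆ ℝ × E`. -/
def boundFrame {E : Type*} [AddCommGroup E] (B : Set E) : Set (ℝ × E) :=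
  {((1 : ℝ), (0 : E))} ∪ ({(0 : ℝ)} ×ˢ B)

/-!
The operator is Seeley's reflection series with parameters. Choose weights `c` with
`∑ⱼ |cⱼ| 2 ^ (j n) < ∞` and `∑ⱼ cⱼ (-2ʲ)ⁿ = 1` for all `n` (`exists_isSeeleyWeight`), and a cutoff
function `χ` which is `1` near `b` and vanishes near `(-∞, τ]`. With `g (t, x) = χ t • f (t, x)`,
extended by zero to `t ≤ τ`, the extension is `∑ⱼ cⱼ • g (b - 2ʲ (t - b), x)` for `t > b`. For
`t ≥ 2b - τ` all its terms vanish, and for `t` in a compact subset of `(b, ∞)` it is a finite sum;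
hence it makes sense, and can be differentiated term by term, although `F` need not be complete.

Everything is phrased in terms of the family `Φ m = ext(f, m)` of all extended differentials, a
"jet" (`IsJet`). The families satisfying the defining properties of a jet are exactly those that come
from elements of `C^k_{V̆}(V, F)` (`IsJet.extDiff_eq`, `IsCkExt.isJet`), and differentials are
multilinear (`IsJet.exists_multilinearMap`). So it suffices to write down the jet of the extension
(`extJet`) and to verify that it is one (`IsJet.isJet_extJet`):

* the jet of `χ • f` is given by a recursive product rule (`leibniz`);
* the `m`-th differential of the `j`-th term at `(t, x)` is `Ψ m` at `(b - 2ʲ (t - b), x)` in the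
  directions `(-2ʲ r, X)`, where `Ψ` is the jet of `g`. As `t → b`, expansion along `ℝ × {0}` and
  `{0} × E` produces factors `(-2ʲ)ⁿ`, and Tannery's theorem (`tendsto_tsum_smul`) together with the
  moment conditions shows that the sum tends to the differential of `f` at `t = b`
  (`IsJet.tendsto_reflJet`);
* at `t = b` the differentiability follows from continuity and the differentiability elsewhere, by
  the mean value inequality (`hasDirDeriv_of_hyperplane`).

Estimates and compatibility can then be checked on each term of the series: every term only uses
the values of `ext(f, ℓ)` over `[τ, b] × {x}` (`IsJet.seminorm_extJet_le`, `extJet_congr`).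
-/

/-! ### Seminorms and the mean value inequality -/

section MeanValue

set_option linter.unusedSectionVars false

variable {H : Type*} [AddCommGroup H] [Module ℝ H] [TopologicalSpace H]
variable {F : Type*} [AddCommGroup F] [Module ℝ F] [TopologicalSpace F]

theorem tendsto_nhds_of_seminorm [IsTopologicalAddGroup F] [ContinuousSMul ℝ F]
    [LocallyConvexSpace ℝ F] {α : Type*} {l : Filter α} {u : α → F} {y : F}
    (h : ∀ p : Seminorm ℝ F, Continuous p → ∀ ε > 0, ∀ᶠ q in l, p (u q - y) ≤ ε) :
    Tendsto u l (𝓝 y) := by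
  have hF := PolynormableSpace.withSeminorms ℝ F
  rw [hF.tendsto_nhds]
  intro p ε hε
  filter_upwards [h p.1 p.2 (ε / 2) (half_pos hε)] with q hq
  exact lt_of_le_of_lt hq (half_lt_self hε)

/-- Hahn-Banach: a continuous seminorm is attained at `y` by a functional which it dominates. -/
theorem Seminorm.exists_strongDual_apply_eq [IsTopologicalAddGroup F] [ContinuousSMul ℝ F]
    [LocallyConvexSpace ℝ F] {p : Seminorm ℝ F} (hp : Continuous p) (y : F) :
    ∃ g : StrongDual ℝ F, g y = p y ∧ ∀ x, g x ≤ p x := by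
  rcases eq_or_ne y 0 with rfl | hy
  · exact ⟨0, by simp, fun x => by simp⟩
  let f : F →ₗ.[ℝ] ℝ := LinearPMap.mkSpanSingleton y (p y) hy
  obtain ⟨g, hg, hgp⟩ := Module.Dual.exists_continuous_extension_of_le_seminorm_real f.domain
    f.toFun hp (by
      rintro ⟨x, hx⟩
      obtain ⟨c, rfl⟩ := Submodule.mem_span_singleton.1 hx
      have : f.toFun ⟨c • y, hx⟩ = c • p y := LinearPMap.mkSpanSingleton'_apply y (p y) _ c _
      rw [this, map_smul_eq_mul, smul_eq_mul]
      exact mul_le_mul_of_nonneg_right (le_abs_self c) (apply_nonneg p y))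
  refine ⟨g, ?_, fun x => (le_abs_self _).trans (hgp x)⟩
  have hy' : y ∈ f.domain := Submodule.mem_span_singleton_self y
  exact (hg ⟨y, hy'⟩).trans (LinearPMap.mkSpanSingleton'_apply_self y (p y) _ hy')

theorem HasDirDeriv.smul [ContinuousConstSMul ℝ F] {g : H → F} {y : F} {x v : H}
    (h : HasDirDeriv g y x v) (c : ℝ) : HasDirDeriv g (c • y) x (c • v) := by
  rcases eq_or_ne c 0 with rfl | hc
  · simp only [HasDirDeriv, smul_zero, add_zero, sub_self, zero_smul]
    exact tendsto_const_nhds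
  have h1 : Tendsto (fun t : ℝ => t * c) (𝓝[≠] 0) (𝓝[≠] 0) := by
    refine tendsto_nhdsWithin_iff.2 ⟨?_, ?_⟩
    · have : Continuous (fun t : ℝ => t * c) := by fun_prop
      simpa using (this.tendsto 0).mono_left nhdsWithin_le_nhds
    · filter_upwards [self_mem_nhdsWithin] with t ht
      exact mul_ne_zero ht hc
  refine ((Tendsto.comp h h1).const_smul c).congr fun t => ?_
  simp only [Function.comp_apply, smul_smul, mul_inv_rev]
  rw [← mul_assoc, mul_inv_cancel₀ hc, one_mul]

theorem HasDirDeriv.congr_of_eventuallyEq [ContinuousAdd H] [ContinuousSMul ℝ H]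
    {g h : H → F} {y : F} {x v : H}
    (hg : HasDirDeriv g y x v) (hgh : g =ᶠ[𝓝 x] h) : HasDirDeriv h y x v := by
  have h1 : Tendsto (fun t : ℝ => x + t • v) (𝓝[≠] 0) (𝓝 x) := by
    have : Continuous (fun t : ℝ => x + t • v) := by fun_prop
    simpa using (this.tendsto 0).mono_left nhdsWithin_le_nhds
  refine Tendsto.congr' ?_ hg
  filter_upwards [h1 hgh] with t ht
  rw [show g (x + t • v) = h (x + t • v) from ht, hgh.eq_of_nhds]

theorem HasDirDeriv.unique [T2Space F] {g : H → F} {x v : H} {y y' : F}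
    (h : HasDirDeriv g y x v) (h' : HasDirDeriv g y' x v) : y = y' :=
  tendsto_nhds_unique h h'

theorem hasDirDeriv_const (c : F) (x v : H) : HasDirDeriv (fun _ => c) 0 x v := by
  simp only [HasDirDeriv, sub_self, smul_zero]
  exact tendsto_const_nhds

theorem HasDirDeriv.add [ContinuousAdd F] {g h : H → F} {y y' : F} {x v : H}
    (hg : HasDirDeriv g y x v) (hh : HasDirDeriv h y' x v) :
    HasDirDeriv (fun z => g z + h z) (y + y') x v := by
  refine (Tendsto.add hg hh).congr fun t => ?_
  module

theorem HasDirDeriv.const_smul [ContinuousConstSMul ℝ F] {g : H → F} {y : F} {x v : H}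
    (hg : HasDirDeriv g y x v) (c : ℝ) : HasDirDeriv (fun z => c • g z) (c • y) x v := by
  refine (Tendsto.const_smul hg c).congr fun t => ?_
  module

theorem HasDirDeriv.sum [ContinuousAdd F] {ι : Type*} (s : Finset ι) {g : ι → H → F} {y : ι → F}
    {x v : H} (hg : ∀ i ∈ s, HasDirDeriv (g i) (y i) x v) :
    HasDirDeriv (fun z => ∑ i ∈ s, g i z) (∑ i ∈ s, y i) x v := by
  classical
  induction s using Finset.induction_on with
  | empty => simpa using hasDirDeriv_const (0 : F) x v
  | insert i s hi ih =>
    simp only [Finset.sum_insert hi]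
    exact (hg i (by simp)).add (ih fun j hj => hg j (by simp [hj]))

/-- The directional derivative along a segment, composed with a continuous linear functional, is an
ordinary derivative of a real function. -/
theorem HasDirDeriv.hasDerivAt_strongDual {g : H → F} {y : F} {z v : H} {σ : ℝ}
    (h : HasDirDeriv g y (z + σ • v) v) (Λ : StrongDual ℝ F) :
    HasDerivAt (fun s : ℝ => Λ (g (z + s • v))) (Λ y) σ := by
  rw [hasDerivAt_iff_tendsto_slope_zero]
  refine ((Λ.continuous.tendsto y).comp h).congr fun t => ?_
  simp only [Function.comp_apply, map_smul, map_sub]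
  rw [add_smul, add_assoc]

/-- Mean value inequality along a segment. Differentiability is only needed at the interior points
of the segment; Hahn-Banach reduces the inequality to the mean value theorem on `[0, 1]`. -/
theorem seminorm_sub_sub_le_of_hasDirDeriv [IsTopologicalAddGroup F] [ContinuousSMul ℝ F]
    [LocallyConvexSpace ℝ F] {p : Seminorm ℝ F} (hp : Continuous p) {g : H → F} {z v : H}
    {D : ℝ → F} {y : F} {ε : ℝ}
    (hc : ContinuousOn (fun σ : ℝ => g (z + σ • v)) (Icc 0 1))
    (hd : ∀ σ ∈ Ioo (0 : ℝ) 1, HasDirDeriv g (D σ) (z + σ • v) v)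
    (hD : ∀ σ ∈ Ioo (0 : ℝ) 1, p (D σ - y) ≤ ε) :
    p (g (z + v) - g z - y) ≤ ε := by
  obtain ⟨Λ, hΛ, hΛp⟩ := Seminorm.exists_strongDual_apply_eq hp (g (z + v) - g z - y)
  obtain ⟨σ, hσ, h⟩ := exists_hasDerivAt_eq_slope (fun σ : ℝ => Λ (g (z + σ • v)))
    (fun σ => Λ (D σ)) zero_lt_one (Λ.continuous.comp_continuousOn hc)
    (fun σ hσ => (hd σ hσ).hasDerivAt_strongDual Λ)
  have h' : Λ (D σ) = Λ (g (z + v)) - Λ (g z) := by simpa using h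
  rw [← hΛ]
  calc Λ (g (z + v) - g z - y) = Λ (D σ - y) := by simp only [map_sub, h']
    _ ≤ p (D σ - y) := hΛp _
    _ ≤ ε := hD σ hσ

/-- A neighbourhood of `z₀` contains all short segments in direction `v` that start near `z₀`. -/
theorem eventually_segment [IsTopologicalAddGroup H] [ContinuousSMul ℝ H]
    {z₀ v : H} {P : H → Prop} (hP : ∀ᶠ z in 𝓝 z₀, P z) :
    ∀ᶠ q : H × ℝ in 𝓝 (z₀, 0), ∀ σ ∈ Icc (0 : ℝ) 1, P (q.1 + σ • (q.2 • v)) := by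
  refine isCompact_Icc.eventually_forall_of_forall_eventually
    (P := fun (q : H × ℝ) (σ : ℝ) => P (q.1 + σ • (q.2 • v))) fun σ _ => ?_
  have hc : Continuous (fun r : (H × ℝ) × ℝ => r.1.1 + r.2 • (r.1.2 • v)) := by fun_prop
  have := hc.tendsto ((z₀, 0), σ)
  simp only [zero_smul, smul_zero, add_zero] at this
  exact this hP

/-- Difference quotients in direction `v` converge to the directional derivative uniformly in
the base point `z → z₀`, as long as the directional derivative `D` is continuous at `z₀`. The
function need only be differentiable off a set `N` which the open segments in question avoid. -/
theorem eventually_seminorm_diffQuotient_le [IsTopologicalAddGroup H] [ContinuousSMul ℝ H]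
    [IsTopologicalAddGroup F] [ContinuousSMul ℝ F] [LocallyConvexSpace ℝ F]
    {U N : Set H} (hU : IsOpen U) {g D : H → F} {z₀ v : H} (hz₀ : z₀ ∈ U)
    (hg : ContinuousOn g U) (hd : ∀ z ∈ U, z ∉ N → HasDirDeriv g (D z) z v)
    (hD : ContinuousAt D z₀) {p : Seminorm ℝ F} (hp : Continuous p) {ε : ℝ} (hε : 0 < ε) :
    ∀ᶠ q : H × ℝ in 𝓝 (z₀, 0), q.2 ≠ 0 →
      (∀ σ ∈ Ioo (0 : ℝ) 1, q.1 + σ • (q.2 • v) ∉ N) →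
      p (q.2⁻¹ • (g (q.1 + q.2 • v) - g q.1) - D z₀) ≤ ε := by
  have h1 : ∀ᶠ z in 𝓝 z₀, z ∈ U ∧ p (D z - D z₀) ≤ ε := by
    refine Filter.Eventually.and (hU.mem_nhds hz₀) ?_
    have h2 : ContinuousAt (fun z => p (D z - D z₀)) z₀ :=
      hp.continuousAt.comp (hD.sub continuousAt_const)
    refine (h2.eventually_lt (g := fun _ => ε) continuousAt_const ?_).mono fun z hz => hz.le
    simpa using hε
  filter_upwards [eventually_segment (v := v) h1] with q hq hs hN
  have key := seminorm_sub_sub_le_of_hasDirDeriv hp (g := g) (z := q.1) (v := q.2 • v)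
    (D := fun σ => q.2 • D (q.1 + σ • (q.2 • v))) (y := q.2 • D z₀) (ε := |q.2| * ε)
    (hg.comp (Continuous.continuousOn (by fun_prop)) fun σ hσ => (hq σ hσ).1)
    (fun σ hσ => (hd _ (hq σ (Ioo_subset_Icc_self hσ)).1 (hN σ hσ)).smul q.2)
    (fun σ hσ => by
      rw [← smul_sub, map_smul_eq_mul, Real.norm_eq_abs]
      exact mul_le_mul_of_nonneg_left (hq σ (Ioo_subset_Icc_self hσ)).2 (abs_nonneg _))
  have h3 : q.2⁻¹ • (g (q.1 + q.2 • v) - g q.1) - D z₀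
      = q.2⁻¹ • (g (q.1 + q.2 • v) - g q.1 - q.2 • D z₀) := by
    rw [smul_sub _ _ (q.2 • D z₀), smul_smul, inv_mul_cancel₀ hs, one_smul]
  rw [h3, map_smul_eq_mul, norm_inv, Real.norm_eq_abs]
  rw [inv_mul_le_iff₀ (abs_pos.2 hs)]
  exact key

/-- The directional derivatives of a `C¹`-map are additive in the direction. -/
theorem HasDirDeriv.add_dir [IsTopologicalAddGroup H] [ContinuousSMul ℝ H]
    [IsTopologicalAddGroup F] [ContinuousSMul ℝ F] [LocallyConvexSpace ℝ F]
    {U : Set H} (hU : IsOpen U) {g D : H → F} {z u v : H} {y : F} (hz : z ∈ U)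
    (hg : ContinuousOn g U) (hd : ∀ z ∈ U, HasDirDeriv g (D z) z v) (hD : ContinuousAt D z)
    (hy : HasDirDeriv g y z u) : HasDirDeriv g (y + D z) z (u + v) := by
  have h1 : Tendsto (fun s : ℝ => s⁻¹ • (g (z + s • u + s • v) - g (z + s • u)))
      (𝓝[≠] 0) (𝓝 (D z)) := by
    refine tendsto_nhds_of_seminorm fun p hp ε hε => ?_
    have h2 := eventually_seminorm_diffQuotient_le (N := ∅) hU hz hg (fun z hz _ => hd z hz) hD hp
      hε
    have hc : Continuous (fun s : ℝ => ((z + s • u, s) : H × ℝ)) := by fun_prop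
    have h3 := hc.tendsto 0
    simp only [zero_smul, add_zero] at h3
    filter_upwards [(h3.mono_left nhdsWithin_le_nhds).eventually h2, self_mem_nhdsWithin]
      with s hs hs0
    exact hs hs0 (by simp)
  refine (Tendsto.add hy h1).congr fun s => ?_
  rw [← smul_add, smul_add s u v, ← add_assoc]
  congr 1
  abel

/-- A continuous map on an open set which has, off the hyperplane `{y | φ y = φ z}`, a
directional derivative `D` in direction `v` that is continuous at `z`, is differentiable in
direction `v` at `z`. -/
theorem hasDirDeriv_of_hyperplane [IsTopologicalAddGroup H] [ContinuousSMul ℝ H]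
    [IsTopologicalAddGroup F] [ContinuousSMul ℝ F] [LocallyConvexSpace ℝ F]
    {U : Set H} (hU : IsOpen U) {g D : H → F} {z v : H} (hz : z ∈ U)
    (φ : StrongDual ℝ H) (hφ : φ ≠ 0) (hg : ContinuousOn g U)
    (hd : ∀ y ∈ U, φ y ≠ φ z → HasDirDeriv g (D y) y v) (hD : ContinuousAt D z) :
    HasDirDeriv g (D z) z v := by
  refine tendsto_nhds_of_seminorm fun p hp ε hε => ?_
  have h1 := eventually_seminorm_diffQuotient_le (N := {y | φ y = φ z}) hU hz hg
    (fun y hy hyN => hd y hy hyN) hD hp hε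
  by_cases hv : φ v = 0
  · -- the line through `z` lies in the hyperplane: approximate it by parallel lines
    obtain ⟨e, he⟩ : ∃ e, φ e ≠ 0 := by
      by_contra! h
      exact hφ (by ext x; simpa using h x)
    have h2 : ∀ᶠ q : H × ℝ in 𝓝 (z, 0), q.1 ∈ U ∧ q.1 + q.2 • v ∈ U := by
      filter_upwards [eventually_segment (v := v) (P := (· ∈ U)) (hU.mem_nhds hz)] with q hq
      exact ⟨by simpa using hq 0 (by simp), by simpa using hq 1 (by simp)⟩
    have h3 := ((continuous_swap.tendsto ((0 : ℝ), z)).eventually (h1.and h2)).curry_nhds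
    filter_upwards [h3.filter_mono nhdsWithin_le_nhds, self_mem_nhdsWithin] with s hs hs0
    have hU1 : z ∈ U ∧ z + s • v ∈ U := hs.self_of_nhds.2
    have hcont : ContinuousAt (fun y => p (s⁻¹ • (g (y + s • v) - g y) - D z)) z := by
      have h4 : ContinuousAt g z := hg.continuousAt (hU.mem_nhds hU1.1)
      have h5 : ContinuousAt (fun y => g (y + s • v)) z :=
        ContinuousAt.comp (g := g) (f := fun y => y + s • v)
          (hg.continuousAt (hU.mem_nhds hU1.2)) (by fun_prop)
      exact hp.continuousAt.comp (((h5.sub h4).const_smul _).sub continuousAt_const)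
    have hc : Continuous (fun r : ℝ => z + r • e) := by fun_prop
    have h6 : Tendsto (fun r : ℝ => z + r • e) (𝓝[≠] 0) (𝓝 z) := by
      simpa using (hc.tendsto 0).mono_left nhdsWithin_le_nhds
    refine le_of_tendsto (hcont.tendsto.comp h6) ?_
    filter_upwards [h6.eventually hs, self_mem_nhdsWithin] with r hr hr0
    refine hr.1 hs0 fun σ _ h => ?_
    have : r * φ e = 0 := by simpa [hv] using h
    exact (mul_ne_zero hr0 he) this
  · have hc : Continuous (fun s : ℝ => ((z, s) : H × ℝ)) := by fun_prop
    filter_upwards [((hc.tendsto 0).mono_left nhdsWithin_le_nhds).eventually h1,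
      self_mem_nhdsWithin] with s hs hs0
    refine hs hs0 fun σ hσ h => ?_
    have : σ * (s * φ v) = 0 := by simpa using h
    rcases mul_eq_zero.1 this with h | h
    · exact hσ.1.ne' h
    · exact (mul_ne_zero hs0 hv) h

end MeanValue

/-! ### Jets -/

section Jet

set_option linter.unusedSectionVars false

variable {H : Type*} [AddCommGroup H] [Module ℝ H] [TopologicalSpace H]
  [IsTopologicalAddGroup H] [ContinuousSMul ℝ H]
variable {F : Type*} [AddCommGroup F] [Module ℝ F] [TopologicalSpace F]
  [IsTopologicalAddGroup F] [ContinuousSMul ℝ F]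

/-- A jet of order `k` over `(V, V̆)`: a family `Φ m : H → Hᵐ → F` of maps, continuous on
`V̆ × Hᵐ` for `m ≤ k`, such that `Φ (m + 1)` is the differential of `Φ m` on `V`. The values of
`Φ m` outside of `V̆` are irrelevant. Jets are the families `(ext(f, m))_m` with `f` in
`C^k_{V̆}(V, F)`. -/
structure IsJet (k : ℕ∞) (P : Omega H) (Φ : ∀ m : ℕ, H → (Fin m → H) → F) : Prop where
  continuousOn : ∀ m : ℕ, (m : ℕ∞) ≤ k →
    ContinuousOn (fun q : H × (Fin m → H) => Φ m q.1 q.2) (P.outer ×ˢ univ)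
  hasDirDeriv : ∀ m : ℕ, ((m + 1 : ℕ) : ℕ∞) ≤ k → ∀ w : Fin m → H, ∀ z ∈ P.inner, ∀ v : H,
    HasDirDeriv (fun y => Φ m y w) (Φ (m + 1) z (Fin.snoc w v)) z v

variable {k : ℕ∞} {P : Omega H} {Φ : ∀ m : ℕ, H → (Fin m → H) → F}

theorem natCast_le_of_succ_le {m : ℕ} {k : ℕ∞} (h : ((m + 1 : ℕ) : ℕ∞) ≤ k) : (m : ℕ∞) ≤ k :=
  le_trans (by exact_mod_cast Nat.le_succ m) h

theorem zeroExt_apply_of_mem {U : Set H} (f : U → F) {x : H} (hx : x ∈ U) :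
    zeroExt f x = f ⟨x, hx⟩ :=
  Subtype.val_injective.extend_apply f 0 ⟨x, hx⟩

theorem Omega.eventually_mem_inner {z : H} (hz : z ∈ P.inner) : ∀ᶠ y in 𝓝 z, y ∈ P.inner :=
  P.isOpen_inner.mem_nhds hz

theorem IsJet.continuousOn_left (h : IsJet k P Φ) {m : ℕ} (hm : (m : ℕ∞) ≤ k) (w : Fin m → H) :
    ContinuousOn (fun y => Φ m y w) P.outer :=
  (h.continuousOn m hm).comp (f := fun y => (y, w)) (by fun_prop) fun _ hy => ⟨hy, mem_univ _⟩

theorem IsJet.iterDiff_eq [T2Space F] (h : IsJet k P Φ) {f : P.inner → F}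
    (hf : ∀ z : P.inner, f z = Φ 0 z ![]) (m : ℕ) : (m : ℕ∞) ≤ k → ∀ z ∈ P.inner,
    ∀ w : Fin m → H, iterDiff (zeroExt f) m z w = Φ m z w := by
  induction m with
  | zero =>
    intro _ z hz w
    rw [Subsingleton.elim w ![], iterDiff, zeroExt_apply_of_mem f hz, hf]
  | succ m ih =>
    intro hm z hz w
    have h1 := h.hasDirDeriv m hm (Fin.init w) z hz (w (Fin.last m))
    rw [Fin.snoc_init_self] at h1
    refine (h1.congr_of_eventuallyEq ?_).dirDeriv_eq
    filter_upwards [P.eventually_mem_inner hz] with y hy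
    exact (ih (natCast_le_of_succ_le hm) y hy _).symm

theorem IsJet.isCkExt [T2Space F] (h : IsJet k P Φ) {f : P.inner → F}
    (hf : ∀ z : P.inner, f z = Φ 0 z ![]) : IsCkExt k P f := by
  refine ⟨⟨fun m hm w z hz v => ⟨Φ (m + 1) z (Fin.snoc w v), ?_⟩, fun m hm => ?_⟩,
    fun m hm => ⟨fun q => Φ m q.1 q.2, h.continuousOn m hm, fun z hz w => ?_⟩⟩
  · refine (h.hasDirDeriv m hm w z hz v).congr_of_eventuallyEq ?_
    filter_upwards [P.eventually_mem_inner hz] with y hy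
    exact (h.iterDiff_eq hf m (natCast_le_of_succ_le hm) y hy w).symm
  · refine ((h.continuousOn m hm).mono (prod_mono P.inner_subset_outer subset_rfl)).congr ?_
    intro q hq
    exact h.iterDiff_eq hf m hm q.1 hq.1 q.2
  · exact (h.iterDiff_eq hf m hm z hz w).symm

theorem IsJet.extDiff_eq [T2Space F] (h : IsJet k P Φ) {f : P.inner → F}
    (hf : ∀ z : P.inner, f z = Φ 0 z ![]) {m : ℕ} (hm : (m : ℕ∞) ≤ k) {z : H} (hz : z ∈ P.outer)
    (w : Fin m → H) : extDiff P f m z w = Φ m z w :=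
  extDiff_eq_of_continuousOn P f m (fun q => Φ m q.1 q.2) (h.continuousOn m hm)
    (fun z hz w => (h.iterDiff_eq hf m hm z hz w).symm) hz w

theorem IsCkExt.extDiff_eq_iterDiff [T2Space F] {f : P.inner → F} (hf : IsCkExt k P f) {m : ℕ}
    (hm : (m : ℕ∞) ≤ k) {z : H} (hz : z ∈ P.inner) (w : Fin m → H) :
    extDiff P f m z w = iterDiff (zeroExt f) m z w := by
  obtain ⟨Φ, hc, hΦ⟩ := hf.2 m hm
  rw [extDiff_eq_of_continuousOn P f m Φ hc hΦ (P.inner_subset_outer hz), hΦ z hz]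

theorem IsCkExt.isJet [T2Space F] {f : P.inner → F} (hf : IsCkExt k P f) :
    IsJet k P (extDiff P f) := by
  refine ⟨fun m hm => ?_, fun m hm w z hz v => ?_⟩
  · obtain ⟨Φ, hc, hΦ⟩ := hf.2 m hm
    exact hc.congr fun q hq => extDiff_eq_of_continuousOn P f m Φ hc hΦ hq.1 q.2
  · have h1 := hasDirDeriv_dirDeriv (hf.1.1 m hm w z hz v)
    have h2 : extDiff P f (m + 1) z (Fin.snoc w v)
        = dirDeriv (fun y => iterDiff (zeroExt f) m y w) z v := by
      rw [hf.extDiff_eq_iterDiff hm hz]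
      simp [iterDiff]
    rw [h2]
    refine h1.congr_of_eventuallyEq ?_
    filter_upwards [P.eventually_mem_inner hz] with y hy
    exact (hf.extDiff_eq_iterDiff (natCast_le_of_succ_le hm) hy w).symm

theorem extDiff_smul_add [T2Space F] {f g : P.inner → F} (hf : IsCkExt k P f)
    (hg : IsCkExt k P g) (c : ℝ) {m : ℕ} (hm : (m : ℕ∞) ≤ k) {z : H} (hz : z ∈ P.outer)
    (w : Fin m → H) :
    extDiff P (c • f + g) m z w = c • extDiff P f m z w + extDiff P g m z w := by
  refine extDiff_eq_of_continuousOn P _ m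
    (fun q => c • extDiff P f m q.1 q.2 + extDiff P g m q.1 q.2) ?_ (fun z hz w => ?_) hz w
  · exact ((hf.isJet.continuousOn m hm).const_smul c).add (hg.isJet.continuousOn m hm)
  · simp only
    rw [hf.extDiff_eq_iterDiff hm hz, hg.extDiff_eq_iterDiff hm hz, zeroExt_smul_add,
      iterDiff_smul_add P.isOpen_inner hf.1 hg.1 c m hm z hz]

/-- The multilinearity of differentials, in the form suited for an induction on the order. -/
theorem IsJet.map_update_inner [LocallyConvexSpace ℝ F] [T2Space F] (h : IsJet k P Φ) (m : ℕ) :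
    (m : ℕ∞) ≤ k → ∀ z ∈ P.inner, ∀ (w : Fin m → H) (i : Fin m) (c : ℝ) (u v : H),
      Φ m z (Function.update w i (c • u + v))
        = c • Φ m z (Function.update w i u) + Φ m z (Function.update w i v) := by
  induction m with
  | zero => intro _ _ _ _ i; exact i.elim0
  | succ m ih =>
    intro hm z hz w i c u v
    have hm' := natCast_le_of_succ_le hm
    have hd := h.hasDirDeriv m hm
    rw [← Fin.snoc_init_self w]
    generalize Fin.init w = w', w (Fin.last m) = x
    refine Fin.lastCases ?_ (fun j => ?_) i
    · -- the last direction is linear because differentials of `C¹`-maps are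
      simp only [Fin.update_snoc_last]
      have h1 := ((hd w' z hz u).smul c).add_dir P.isOpen_inner
        (D := fun y => Φ (m + 1) y (Fin.snoc w' v)) hz
        ((h.continuousOn_left hm' w').mono P.inner_subset_outer) (fun y hy => hd w' y hy v)
        (((h.continuousOn_left hm _).mono P.inner_subset_outer).continuousAt
          (P.isOpen_inner.mem_nhds hz))
      exact (hd w' z hz (c • u + v)).unique h1
    · -- earlier directions are linear at order `m`, and differentiation preserves this
      simp only [← Fin.snoc_update]
      have h1 := ((hd (Function.update w' j u) z hz x).const_smul c).add
        (hd (Function.update w' j v) z hz x)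
      refine (hd (Function.update w' j (c • u + v)) z hz x).unique
        (h1.congr_of_eventuallyEq ?_)
      filter_upwards [P.eventually_mem_inner hz] with y hy
      exact (ih hm' y hy w' j c u v).symm

theorem IsJet.map_update [LocallyConvexSpace ℝ F] [T2Space F] (h : IsJet k P Φ) {m : ℕ}
    (hm : (m : ℕ∞) ≤ k) {z : H} (hz : z ∈ P.outer) (w : Fin m → H) (i : Fin m) (c : ℝ) (u v : H) :
    Φ m z (Function.update w i (c • u + v))
      = c • Φ m z (Function.update w i u) + Φ m z (Function.update w i v) := by
  have hcont := fun w => h.continuousOn_left hm w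
  have h1 : EqOn (fun y => Φ m y (Function.update w i (c • u + v)))
      (fun y => c • Φ m y (Function.update w i u) + Φ m y (Function.update w i v)) P.inner :=
    fun y hy => h.map_update_inner m hm y hy w i c u v
  exact h1.of_subset_closure (hcont _) (((hcont _).const_smul c).add (hcont _))
    P.inner_subset_outer P.outer_subset_closure hz

theorem IsJet.exists_multilinearMap [LocallyConvexSpace ℝ F] [T2Space F] (h : IsJet k P Φ) {m : ℕ}
    (hm : (m : ℕ∞) ≤ k) {z : H} (hz : z ∈ P.outer) :
    ∃ M : MultilinearMap ℝ (fun _ : Fin m => H) F, ∀ w, M w = Φ m z w := by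
  have h0 : ∀ (w : Fin m → H) (i : Fin m), Φ m z (Function.update w i 0) = 0 := fun w i => by
    have := h.map_update hm hz w i 1 0 0
    simpa using this
  refine ⟨MultilinearMap.mk' (fun w => Φ m z w) (fun w i u v => ?_) (fun w i c u => ?_),
    fun w => rfl⟩
  · simpa using h.map_update hm hz w i 1 u v
  · simpa [h0] using h.map_update hm hz w i c u 0

end Jet

/-! ### Products with functions of the first variable -/

section Leibniz

set_option linter.unusedSectionVars false

variable {E : Type u} [AddCommGroup E] [Module ℝ E] [TopologicalSpace E]
  [IsTopologicalAddGroup E] [ContinuousSMul ℝ E]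
variable {F : Type v} [AddCommGroup F] [Module ℝ F] [TopologicalSpace F]
  [IsTopologicalAddGroup F] [ContinuousSMul ℝ F]

/-- The jet of the directional derivative `D_v f` at a point, given the jet `ψ` of `f`. -/
def shiftJet {H F : Type*} (ψ : ∀ m : ℕ, (Fin m → H) → F) (v : H) (m : ℕ) (u : Fin m → H) : F :=
  ψ (m + 1) (Fin.cons v u)

/-- The `ℓ`-th differential of `(t, x) ↦ χ⁽ⁿ⁾(t) • f (t, x)`, where `χ n` is the `n`-th derivative
of a function `χ 0` and `ψ` is the jet of `f` at the point `(t, x)`. The recursion differentiates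
in the first of the directions `w` and applies the product rule. -/
noncomputable def leibniz (χ : ℕ → ℝ → ℝ) : (ℓ : ℕ) → ℕ → ℝ → (∀ m : ℕ, (Fin m → ℝ × E) → F) →
    (Fin ℓ → ℝ × E) → F
  | 0, n, t, ψ, w => χ n t • ψ 0 w
  | ℓ + 1, n, t, ψ, w =>
      (w 0).1 • leibniz χ ℓ (n + 1) t ψ (Fin.tail w)
        + leibniz χ ℓ n t (shiftJet ψ (w 0)) (Fin.tail w)

variable {χ : ℕ → ℝ → ℝ}

theorem leibniz_eq_zero {t : ℝ} (h : ∀ n, χ n t = 0) (ℓ : ℕ) : ∀ (n : ℕ)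
    (ψ : ∀ m : ℕ, (Fin m → ℝ × E) → F) (w : Fin ℓ → ℝ × E), leibniz χ ℓ n t ψ w = 0 := by
  induction ℓ with
  | zero => intro n ψ w; simp [leibniz, h]
  | succ ℓ ih => intro n ψ w; simp [leibniz, ih]

theorem leibniz_succ_eq_zero {t : ℝ} (h : ∀ n, χ (n + 1) t = 0) (ℓ : ℕ) : ∀ (n : ℕ)
    (ψ : ∀ m : ℕ, (Fin m → ℝ × E) → F) (w : Fin ℓ → ℝ × E), leibniz χ ℓ (n + 1) t ψ w = 0 := by
  induction ℓ with
  | zero => intro n ψ w; simp [leibniz, h]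
  | succ ℓ ih => intro n ψ w; simp [leibniz, ih]

theorem leibniz_eq_self {t : ℝ} (h0 : χ 0 t = 1) (h : ∀ n, χ (n + 1) t = 0) (ℓ : ℕ) :
    ∀ (ψ : ∀ m : ℕ, (Fin m → ℝ × E) → F) (w : Fin ℓ → ℝ × E), leibniz χ ℓ 0 t ψ w = ψ ℓ w := by
  induction ℓ with
  | zero => intro ψ w; simp [leibniz, h0]
  | succ ℓ ih =>
    intro ψ w
    rw [leibniz, leibniz_succ_eq_zero h, ih, smul_zero, zero_add, shiftJet, Fin.cons_self_tail]

/-- The parameter space `Y` is general because `leibniz` recurses into jets that are shifted by one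
of the directions, which then becomes a further parameter. -/
theorem continuousOn_leibniz (hχ : ∀ n, Continuous (χ n)) (ℓ : ℕ) :
    ∀ {Y : Type u} [TopologicalSpace Y] {A : Set Y} {t : Y → ℝ}
      {Ψ : Y → ∀ m : ℕ, (Fin m → ℝ × E) → F}, ContinuousOn t A →
      (∀ m ≤ ℓ, ContinuousOn (fun q : Y × (Fin m → ℝ × E) => Ψ q.1 m q.2) (A ×ˢ univ)) → ∀ n,
      ContinuousOn (fun q : Y × (Fin ℓ → ℝ × E) => leibniz χ ℓ n (t q.1) (Ψ q.1) q.2)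
        (A ×ˢ univ) := by
  induction ℓ with
  | zero =>
    intro Y _ A t Ψ ht hΨ n
    exact ((hχ n).comp_continuousOn (ht.comp continuousOn_fst fun q hq => hq.1)).smul
      (hΨ 0 le_rfl)
  | succ ℓ ih =>
    intro Y _ A t Ψ ht hΨ n
    have htail : Continuous fun q : Y × (Fin (ℓ + 1) → ℝ × E) => Fin.tail q.2 :=
      continuous_pi fun i => (continuous_apply i.succ).comp continuous_snd
    refine ContinuousOn.add (ContinuousOn.smul (by fun_prop) ?_) ?_
    · exact (ih ht (fun m hm => hΨ m (hm.trans (Nat.le_succ ℓ))) (n + 1)).comp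
        (f := fun q : Y × (Fin (ℓ + 1) → ℝ × E) => (q.1, Fin.tail q.2))
        (by fun_prop) fun q hq => ⟨hq.1, mem_univ _⟩
    · have h1 := ih (Y := Y × (ℝ × E)) (A := A ×ˢ univ) (t := fun q => t q.1)
        (Ψ := fun q => shiftJet (Ψ q.1) q.2)
        (ht.comp continuousOn_fst fun q hq => hq.1) (fun m hm => ?_) n
      · exact h1.comp
          (f := fun q : Y × (Fin (ℓ + 1) → ℝ × E) => ((q.1, q.2 0), Fin.tail q.2))
          (by fun_prop) fun q hq => ⟨⟨hq.1, mem_univ _⟩, mem_univ _⟩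
      · refine (hΨ (m + 1) (Nat.succ_le_succ hm)).comp
          (f := fun q : (Y × (ℝ × E)) × (Fin m → ℝ × E) =>
            (q.1.1, (Fin.cons q.1.2 q.2 : Fin (m + 1) → ℝ × E)))
          (Continuous.continuousOn ?_) fun q hq => ⟨hq.1.1, mem_univ _⟩
        refine Continuous.prodMk (by fun_prop) (continuous_pi fun i => ?_)
        refine Fin.cases ?_ (fun j => ?_) i
        · simp only [Fin.cons_zero]; fun_prop
        · simp only [Fin.cons_succ]; fun_prop

/-- The product rule for a function of the first variable. -/
theorem HasDirDeriv.smul_comp_fst {g : ℝ × E → F} {c : ℝ → ℝ} {c' : ℝ} {y : F}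
    {z v : ℝ × E} (hc : HasDerivAt c c' z.1) (hg : HasDirDeriv g y z v) :
    HasDirDeriv (fun x => c x.1 • g x) (v.1 • c' • g z + c z.1 • y) z v := by
  have hline : HasDerivAt (fun t : ℝ => c (z.1 + t * v.1)) (c' * v.1) 0 := by
    have h1 : HasDerivAt (fun t : ℝ => z.1 + t * v.1) v.1 0 := by
      simpa using ((hasDerivAt_id (0 : ℝ)).mul_const v.1).const_add z.1
    have h2 : HasDerivAt c c' (z.1 + 0 * v.1) := by simpa using hc
    exact h2.comp 0 h1
  have h3 : Tendsto (fun t : ℝ => c (z.1 + t * v.1)) (𝓝[≠] 0) (𝓝 (c z.1)) := by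
    simpa using hline.continuousAt.tendsto.mono_left nhdsWithin_le_nhds
  have h4 := hasDerivAt_iff_tendsto_slope_zero.1 hline
  simp only [zero_add, zero_mul, add_zero, smul_eq_mul] at h4
  have h5 := (h4.smul_const (g z)).add (h3.smul hg)
  rw [smul_smul, mul_comm v.1]
  refine h5.congr fun t => ?_
  simp only [Prod.fst_add, Prod.smul_fst, smul_eq_mul]
  module

/-- Differentiation in a last direction `v` commutes with the recursion on the first one, so that
`leibniz` is indeed the family of iterated differentials of the product. -/
theorem hasDirDeriv_leibniz (hχ : ∀ n t, HasDerivAt (χ n) (χ (n + 1) t) t) {z v : ℝ × E}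
    (ℓ : ℕ) : ∀ {Ψ : ℝ × E → ∀ m : ℕ, (Fin m → ℝ × E) → F},
      (∀ m ≤ ℓ, ∀ u : Fin m → ℝ × E,
        HasDirDeriv (fun y => Ψ y m u) (Ψ z (m + 1) (Fin.snoc u v)) z v) →
      ∀ (n : ℕ) (w : Fin ℓ → ℝ × E), HasDirDeriv (fun y => leibniz χ ℓ n y.1 (Ψ y) w)
        (leibniz χ (ℓ + 1) n z.1 (Ψ z) (Fin.snoc w v)) z v := by
  induction ℓ with
  | zero =>
    intro Ψ hΨ n w
    have h1 := (hΨ 0 le_rfl w).smul_comp_fst (hχ n z.1)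
    have h2 : (Fin.snoc w v : Fin 1 → ℝ × E) = Fin.cons v w := by
      ext i : 1
      obtain rfl : i = 0 := Fin.fin_one_eq_zero i
      rfl
    rw [h2] at h1 ⊢
    simpa only [leibniz, shiftJet, Fin.tail_cons, Fin.cons_zero] using h1
  | succ ℓ ih =>
    intro Ψ hΨ n w
    rw [← Fin.cons_self_tail w]
    generalize w 0 = x, Fin.tail w = w'
    rw [← Fin.cons_snoc_eq_snoc_cons]
    have h1 := ih (fun m hm u => hΨ m (hm.trans (Nat.le_succ ℓ)) u) (n + 1) w'
    have h2 := ih (Ψ := fun y => shiftJet (Ψ y) x) (fun m hm u => by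
      have := hΨ (m + 1) (Nat.succ_le_succ hm) (Fin.cons x u)
      rwa [← Fin.cons_snoc_eq_snoc_cons] at this) n w'
    have h3 := (h1.const_smul x.1).add h2
    simp only [leibniz, Fin.tail_cons, Fin.cons_zero] at h3 ⊢
    exact h3

/-- The factor `2 ^ ℓ` counts the terms of the product rule. Each of them trades some directions for
their first components, which is why `S` has to bound these components on `Q`. -/
theorem seminorm_leibniz_le {p : Seminorm ℝ F} {A : ℕ → ℝ} (hA : Monotone A) {t : ℝ}
    (hχA : ∀ n, |χ n t| ≤ A n) {Q : Set (ℝ × E)} {S : ℝ} (hS : 0 ≤ S) (hQ : ∀ v ∈ Q, |v.1| ≤ S)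
    (ℓ : ℕ) : ∀ {ψ : ∀ m : ℕ, (Fin m → ℝ × E) → F} {N : ℝ}, 0 ≤ N →
      (∀ m ≤ ℓ, ∀ u : Fin m → ℝ × E, (∀ i, u i ∈ Q) → p (ψ m u) ≤ N * S ^ m) →
      ∀ (n : ℕ) (w : Fin ℓ → ℝ × E), (∀ i, w i ∈ Q) →
        p (leibniz χ ℓ n t ψ w) ≤ 2 ^ ℓ * A (n + ℓ) * (N * S ^ ℓ) := by
  have hA0 : ∀ n, 0 ≤ A n := fun n => (abs_nonneg _).trans (hχA n)
  induction ℓ with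
  | zero =>
    intro ψ N hN hψ n w hw
    rw [leibniz, map_smul_eq_mul, Real.norm_eq_abs, pow_zero, one_mul, add_zero]
    exact mul_le_mul (hχA n) (hψ 0 le_rfl w hw) (apply_nonneg p _) (hA0 n)
  | succ ℓ ih =>
    intro ψ N hN hψ n w hw
    have hw' : ∀ i, Fin.tail w i ∈ Q := fun i => hw _
    have h1 := ih hN (fun m hm => hψ m (hm.trans (Nat.le_succ ℓ))) (n + 1) (Fin.tail w) hw'
    have h2 := ih (ψ := shiftJet ψ (w 0)) (mul_nonneg hN hS) (fun m hm u hu => by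
      refine (hψ (m + 1) (Nat.succ_le_succ hm) (Fin.cons (w 0) u) fun i => ?_).trans_eq (by ring)
      refine Fin.cases ?_ (fun j => ?_) i
      · simpa using hw 0
      · simpa using hu j) n (Fin.tail w) hw'
    rw [show n + 1 + ℓ = n + (ℓ + 1) by ring] at h1
    have h3 : A (n + ℓ) ≤ A (n + (ℓ + 1)) := hA (by omega)
    rw [leibniz]
    refine (map_add_le_add p _ _).trans ?_
    rw [map_smul_eq_mul, Real.norm_eq_abs]
    calc _ ≤ S * (2 ^ ℓ * A (n + (ℓ + 1)) * (N * S ^ ℓ))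
          + 2 ^ ℓ * A (n + (ℓ + 1)) * (N * S * S ^ ℓ) := by
          refine add_le_add (mul_le_mul (hQ _ (hw 0)) h1 (apply_nonneg p _) hS) (h2.trans ?_)
          gcongr
      _ = _ := by ring

/-- `leibniz` only depends on the values of the jet at tuples of the given directions and on the first
components of these. -/
theorem leibniz_congr {E' : Type u} [AddCommGroup E'] [Module ℝ E'] {W : Type*}
    (α : W → ℝ × E) (β : W → ℝ × E') (hαβ : ∀ v, (α v).1 = (β v).1) {t : ℝ} (ℓ : ℕ) :
    ∀ {ψ : ∀ m : ℕ, (Fin m → ℝ × E) → F} {ψ' : ∀ m : ℕ, (Fin m → ℝ × E') → F},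
      (∀ m ≤ ℓ, ∀ w : Fin m → W, ψ m (fun i => α (w i)) = ψ' m (fun i => β (w i))) →
      ∀ (n : ℕ) (w : Fin ℓ → W),
        leibniz χ ℓ n t ψ (fun i => α (w i)) = leibniz χ ℓ n t ψ' (fun i => β (w i)) := by
  induction ℓ with
  | zero => intro ψ ψ' h n w; simp only [leibniz]; rw [h 0 le_rfl w]
  | succ ℓ ih =>
    intro ψ ψ' h n w
    rw [leibniz, leibniz, hαβ]
    congr 1
    · congr 1
      exact ih (fun m hm => h m (hm.trans (Nat.le_succ ℓ))) (n + 1) (Fin.tail w)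
    · refine ih (fun m hm u => ?_) n (Fin.tail w)
      have := h (m + 1) (Nat.succ_le_succ hm) (Fin.cons (w 0) u)
      have h1 : ∀ {G : Type u} (γ : W → ℝ × G), (fun i => γ ((Fin.cons (w 0) u : Fin (m + 1) → W) i))
          = Fin.cons (γ (w 0)) (fun i => γ (u i)) := fun γ => by
        ext i : 1
        refine Fin.cases rfl (fun j => rfl) i
      rwa [h1, h1] at this

end Leibniz

/-! ### Cutoff functions -/

section Cutoff

/-- `χ n` is the `n`-th derivative of a smooth function `χ 0` on `ℝ` which vanishes on a
neighbourhood of `(-∞, τ]`, takes the value `1` at `b`, and is flat at `b`. -/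
structure IsCutoff (τ b : ℝ) (χ : ℕ → ℝ → ℝ) : Prop where
  hasDerivAt : ∀ n t, HasDerivAt (χ n) (χ (n + 1) t) t
  exists_eq_zero : ∃ μ > τ, ∀ n, ∀ t < μ, χ n t = 0
  apply_zero : χ 0 b = 1
  apply_succ : ∀ n, χ (n + 1) b = 0

theorem exists_isCutoff {τ b : ℝ} (h : τ < b) : ∃ χ, IsCutoff τ b χ := by
  obtain ⟨μ, hμ, hμb⟩ := exists_between h
  obtain ⟨ν, hν, hνb⟩ := exists_between hμb
  let f : ℝ → ℝ := fun t => Real.smoothTransition ((t - μ) / (ν - μ))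
  have hνμ : 0 < ν - μ := sub_pos.2 hν
  have hf : ContDiff ℝ (⊤ : ℕ∞) f :=
    Real.smoothTransition.contDiff.comp ((contDiff_id.sub contDiff_const).div_const _)
  have hloc : ∀ {t c : ℝ}, f =ᶠ[𝓝 t] (fun _ => c) → ∀ n,
      iteratedDeriv n f t = if n = 0 then c else 0 := fun {t c} ht n => by
    rw [ht.iteratedDeriv_eq n, iteratedDeriv_const]
  have h1 : f =ᶠ[𝓝 b] fun _ => 1 := by
    filter_upwards [lt_mem_nhds hνb] with t ht
    exact Real.smoothTransition.one_of_one_le ((one_le_div hνμ).2 (by linarith))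
  refine ⟨fun n => iteratedDeriv n f, fun n t => ?_, ⟨μ, hμ, fun n t ht => ?_⟩, ?_, fun n => ?_⟩
  · rw [iteratedDeriv_succ]
    exact ((hf.differentiable_iteratedDeriv n (by exact_mod_cast WithTop.coe_lt_top _)) t).hasDerivAt
  · have h0 : f =ᶠ[𝓝 t] fun _ => 0 := by
      filter_upwards [gt_mem_nhds ht] with s hs
      exact Real.smoothTransition.zero_of_nonpos
        (div_nonpos_of_nonpos_of_nonneg (by linarith) hνμ.le)
    simpa using hloc h0 n
  · simpa using hloc h1 0
  · simpa using hloc h1 (n + 1)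

variable {τ b : ℝ} {χ : ℕ → ℝ → ℝ}

theorem IsCutoff.continuous (h : IsCutoff τ b χ) (n : ℕ) : Continuous (χ n) :=
  continuous_iff_continuousAt.2 fun t => (h.hasDerivAt n t).continuousAt

theorem IsCutoff.eq_zero (h : IsCutoff τ b χ) (n : ℕ) {t : ℝ} (ht : t ≤ τ) : χ n t = 0 := by
  obtain ⟨μ, hμ, h0⟩ := h.exists_eq_zero
  exact h0 n t (ht.trans_lt hμ)

theorem IsCutoff.exists_bound (h : IsCutoff τ b χ) :
    ∃ A : ℕ → ℝ, Monotone A ∧ ∀ n, ∀ t ≤ b, |χ n t| ≤ A n := by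
  have h1 : ∀ n, ∃ M, 0 ≤ M ∧ ∀ t ∈ Icc τ b, |χ n t| ≤ M := fun n => by
    obtain ⟨M, hM⟩ := isCompact_Icc.exists_bound_of_continuousOn (s := Icc τ b)
      (h.continuous n).continuousOn
    exact ⟨max M 0, le_max_right _ _, fun t ht => (hM t ht).trans (le_max_left _ _)⟩
  choose M hM0 hM using h1
  refine ⟨fun n => ∑ i ∈ Finset.range (n + 1), M i, fun n m hnm => ?_, fun n t ht => ?_⟩
  · exact Finset.sum_le_sum_of_subset_of_nonneg (Finset.range_mono (by omega)) fun i _ _ => hM0 i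
  · have h2 : M n ≤ ∑ i ∈ Finset.range (n + 1), M i :=
      Finset.single_le_sum (fun i _ => hM0 i) (Finset.self_mem_range_succ n)
    rcases le_total t τ with htτ | htτ
    · rw [h.eq_zero n htτ, abs_zero]
      exact (hM0 n).trans h2
    · exact (hM n t ⟨htτ, ht⟩).trans h2

end Cutoff

/-! ### Series in locally convex spaces -/

section Series

variable {F : Type*} [AddCommGroup F] [Module ℝ F] [TopologicalSpace F]

theorem Seminorm.le_tsum_of_hasSum {ι : Type*} {p : Seminorm ℝ F} (hp : Continuous p) {f : ι → F}
    {S : F} (hS : HasSum f S) (hf : Summable fun i => p (f i)) : p S ≤ ∑' i, p (f i) :=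
  le_of_tendsto' ((hp.tendsto S).comp hS) fun s =>
    (Finset.le_sum_of_subadditive p (map_zero p).le (map_add_le_add p) s f).trans (hf.sum_le_tsum s fun _ _ => apply_nonneg p _)

/-- Tannery's theorem for series which are finite sums, with values in a locally convex space
(completeness is not needed). -/
theorem tendsto_tsum_smul [IsTopologicalAddGroup F] [ContinuousSMul ℝ F]
    [LocallyConvexSpace ℝ F] [T2Space F] {Q : Type*} {l : Filter Q} {a : ℕ → ℝ} {s : ℝ}
    (ha : Summable fun j => |a j|) (hs : HasSum a s) {g : ℕ → Q → F} {y : F}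
    (h1 : ∀ j, Tendsto (g j) l (𝓝 y))
    (h2 : ∀ p : Seminorm ℝ F, Continuous p → ∃ M, ∀ᶠ q in l, ∀ j, p (g j q) ≤ M)
    (h3 : ∀ᶠ q in l, ∃ N, ∀ j ≥ N, g j q = 0) :
    Tendsto (fun q => ∑' j, a j • g j q) l (𝓝 (s • y)) := by
  refine tendsto_nhds_of_seminorm fun p hp ε hε => ?_
  obtain ⟨M, hM⟩ := h2 p hp
  have hb : ∀ q, (∀ j, p (g j q) ≤ M) → ∀ j, |a j| * p (g j q - y) ≤ |a j| * (M + p y) :=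
    fun q hq j => mul_le_mul_of_nonneg_left
      ((map_sub_le_add p _ _).trans (by gcongr; exact hq j)) (abs_nonneg _)
  have h4 : Tendsto (fun q => ∑' j, |a j| * p (g j q - y)) l (𝓝 (∑' j, |a j| * 0)) := by
    refine tendsto_tsum_of_dominated_convergence (ha.mul_right (M + p y)) (fun j => ?_) ?_
    · refine Tendsto.const_mul _ ?_
      have h5 : Tendsto (fun q => p (g j q - y)) l (𝓝 (p (y - y))) :=
        (hp.tendsto _).comp ((h1 j).sub_const y)
      rwa [sub_self, map_zero] at h5
    · filter_upwards [hM] with q hq j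
      rw [Real.norm_of_nonneg (mul_nonneg (abs_nonneg _) (apply_nonneg p _))]
      exact hb q hq j
  simp only [mul_zero, tsum_zero] at h4
  filter_upwards [h4.eventually (gt_mem_nhds hε), hM, h3] with q hq1 hq2 hq3
  obtain ⟨N, hN⟩ := hq3
  have h6 : HasSum (fun j => a j • g j q) (∑' j, a j • g j q) :=
    (summable_of_ne_finset_zero (s := Finset.range N) fun j hj => by
      rw [hN j (by simpa using hj), smul_zero]).hasSum
  have h7 := h6.sub (hs.smul_const y)
  simp only [← smul_sub] at h7
  have h8 := Seminorm.le_tsum_of_hasSum hp h7 (by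
    simp only [map_smul_eq_mul, Real.norm_eq_abs]
    exact (ha.mul_right (M + p y)).of_nonneg_of_le
      (fun j => mul_nonneg (abs_nonneg _) (apply_nonneg p _)) (hb q hq2))
  simp only [map_smul_eq_mul, Real.norm_eq_abs] at h8
  exact h8.trans hq1.le

theorem IsCompact.exists_eventually_le_of_continuousOn {X Y : Type*} [TopologicalSpace X]
    [TopologicalSpace Y] {K : Set X} (hK : IsCompact K) {A : Set Y} {g : X × Y → ℝ}
    (hg : ContinuousOn g (K ×ˢ A)) {y : Y} (hy : y ∈ A) :
    ∃ M, ∀ᶠ y' in 𝓝[A] y, ∀ x ∈ K, g (x, y') ≤ M := by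
  refine hK.induction_on (p := fun S => ∃ M, ∀ᶠ y' in 𝓝[A] y, ∀ x ∈ S, g (x, y') ≤ M)
    ⟨0, by simp⟩ ?_ ?_ fun x hx => ?_
  · rintro S T hST ⟨M, hM⟩
    exact ⟨M, hM.mono fun y' h x hx => h x (hST hx)⟩
  · rintro S T ⟨M, hM⟩ ⟨M', hM'⟩
    refine ⟨max M M', ?_⟩
    filter_upwards [hM, hM'] with y' h h' x hx
    rcases hx with hx | hx
    · exact (h x hx).trans (le_max_left _ _)
    · exact (h' x hx).trans (le_max_right _ _)
  · have h1 : ∀ᶠ q in 𝓝[K] x ×ˢ 𝓝[A] y, g q < g (x, y) + 1 := by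
      rw [← nhdsWithin_prod_eq]
      exact (hg (x, y) ⟨hx, hy⟩).eventually (gt_mem_nhds (lt_add_one _))
    obtain ⟨pa, ha, pb, hb, h⟩ := eventually_prod_iff.1 h1
    exact ⟨{x' | pa x'}, ha, g (x, y) + 1, hb.mono fun y' hy' x' hx' => (h hx' hy').le⟩

end Series

/-! ### Seeley's weights -/

section Weights

/-- Seeley's moment conditions: the reflected series `∑ⱼ cⱼ g (b - 2ʲ (t - b))` has at `t = b` the
same derivatives as `g`. -/
structure IsSeeleyWeight (c : ℕ → ℝ) : Prop where
  summable : ∀ n : ℕ, Summable fun j => |c j| * (2 ^ j) ^ n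
  hasSum : ∀ n : ℕ, HasSum (fun j => c j * (-(2 : ℝ) ^ j) ^ n) 1

/-- The interpolation weight at `1` of the node `-2 ^ j`, for the nodes `-2 ^ i`, `i < N`. -/
noncomputable def lagrangeWeight (N j : ℕ) : ℝ :=
  (Lagrange.basis (Finset.range N) (fun i : ℕ => -(2 : ℝ) ^ i) j).eval 1

theorem injective_neg_two_pow : Function.Injective (fun i : ℕ => -(2 : ℝ) ^ i) := by
  intro i j h
  have h' : (2 : ℝ) ^ i = 2 ^ j := by simpa using h
  exact pow_right_injective₀ (by norm_num) (by norm_num) h'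

/-- Lagrange interpolation reproduces `Xⁿ`; evaluate at `1`. -/
theorem sum_lagrangeWeight {N n : ℕ} (hn : n < N) :
    ∑ j ∈ Finset.range N, lagrangeWeight N j * (-(2 : ℝ) ^ j) ^ n = 1 := by
  have h := Lagrange.eq_interpolate (s := Finset.range N) (f := (Polynomial.X : Polynomial ℝ) ^ n)
    injective_neg_two_pow.injOn (by simpa using hn)
  have h1 := congrArg (Polynomial.eval 1) h
  simp only [Polynomial.eval_pow, Polynomial.eval_X, one_pow, Lagrange.interpolate_apply,
    Polynomial.eval_finsetSum, Polynomial.eval_mul, Polynomial.eval_C] at h1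
  rw [h1]
  exact Finset.sum_congr rfl fun j _ => mul_comm _ _

theorem abs_lagrangeWeight (N j : ℕ) : |lagrangeWeight N j| =
    ∏ i ∈ (Finset.range N).erase j, (1 + (2 : ℝ) ^ i) / |(2 : ℝ) ^ j - 2 ^ i| := by
  rw [lagrangeWeight, Lagrange.basis, Polynomial.eval_prod, Finset.abs_prod]
  refine Finset.prod_congr rfl fun i _ => ?_
  simp only [Lagrange.basisDivisor, Polynomial.eval_mul, Polynomial.eval_C, Polynomial.eval_sub,
    Polynomial.eval_X, sub_neg_eq_add, abs_mul, abs_inv]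
  rw [abs_of_nonneg (by positivity : (0 : ℝ) ≤ 1 + 2 ^ i), div_eq_inv_mul,
    show -(2 : ℝ) ^ j + 2 ^ i = -(2 ^ j - 2 ^ i) by ring, abs_neg]

/-- A bound for the interpolation weights which does not depend on the number of nodes. -/
noncomputable def weightBound (j : ℕ) : ℝ :=
  (∏ i ∈ Finset.range j, 4 * (2 : ℝ)⁻¹ ^ (i + 1)) * Real.exp 4

theorem weightBound_pos (j : ℕ) : 0 < weightBound j := by
  unfold weightBound
  positivity

/-- Nodes `-2 ^ i` with `i < j` contribute at most `4 * 2 ^ (i - j)` to the product, and nodes with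
`j < i` at most `1 + 4 * 2 ^ (j - i)`. -/
theorem abs_lagrangeWeight_le {N j : ℕ} (hj : j < N) : |lagrangeWeight N j| ≤ weightBound j := by
  rw [abs_lagrangeWeight]
  have hsplit : (Finset.range N).erase j = Finset.range j ∪ Finset.Ico (j + 1) N := by
    ext i
    simp only [Finset.mem_erase, Finset.mem_range, Finset.mem_union, Finset.mem_Ico]
    omega
  have hdisj : Disjoint (Finset.range j) (Finset.Ico (j + 1) N) := by
    rw [Finset.disjoint_left]
    intro i
    simp only [Finset.mem_range, Finset.mem_Ico]
    omega
  rw [hsplit, Finset.prod_union hdisj, weightBound]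
  have hpow : ∀ i, (1 : ℝ) ≤ 2 ^ i := fun i => one_le_pow₀ (by norm_num)
  refine mul_le_mul ?_ ?_ (Finset.prod_nonneg fun i _ => by positivity)
    (Finset.prod_nonneg fun i _ => by positivity)
  · -- the nodes below `j`
    rw [← Finset.prod_range_reflect (fun i => 4 * (2 : ℝ)⁻¹ ^ (i + 1))]
    refine Finset.prod_le_prod (fun i _ => by positivity) fun i hi => ?_
    obtain ⟨d, rfl⟩ := Nat.exists_eq_add_of_lt (Finset.mem_range.1 hi)
    rw [show i + d + 1 - 1 - i + 1 = d + 1 by omega]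
    have h1 : (2 : ℝ) ^ (i + d + 1) = 2 ^ i * (2 * 2 ^ d) := by ring
    have h2 : (2 : ℝ) ^ i * (1 * 2 ^ d) ≤ 2 ^ (i + d + 1) - 2 ^ i := by
      rw [h1]
      nlinarith [hpow i, hpow d, mul_le_mul (hpow i) (hpow d) zero_le_one (by positivity)]
    have h3 : (0 : ℝ) < 2 ^ i * (1 * 2 ^ d) := by positivity
    rw [abs_of_pos (h3.trans_le h2), div_le_iff₀ (h3.trans_le h2)]
    calc (1 : ℝ) + 2 ^ i ≤ 2 * 2 ^ i := by linarith [hpow i]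
      _ = 4 * 2⁻¹ ^ (d + 1) * (2 ^ i * (1 * 2 ^ d)) := by
        rw [inv_pow, pow_succ]; field_simp; norm_num
      _ ≤ _ := by gcongr
  · -- the nodes above `j`
    have h0 : ∀ i ∈ Finset.Ico (j + 1) N, (1 + (2 : ℝ) ^ i) / |(2 : ℝ) ^ j - 2 ^ i|
        ≤ Real.exp (4 * (2⁻¹ ^ (i - j))) := by
      intro i hi
      obtain ⟨d, rfl⟩ := Nat.exists_eq_add_of_le (Finset.mem_Ico.1 hi).1
      rw [show j + 1 + d - j = d + 1 by omega]
      refine le_trans ?_ (Real.add_one_le_exp _)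
      have h1 : (2 : ℝ) ^ (j + 1 + d) = 2 ^ j * (2 * 2 ^ d) := by ring
      have h2 : (2 : ℝ) ^ j * 2 ^ d ≤ 2 ^ (j + 1 + d) - 2 ^ j := by
        rw [h1]
        nlinarith [hpow j, hpow d, mul_le_mul (hpow j) (hpow d) zero_le_one (by positivity)]
      have h3 : (0 : ℝ) < 2 ^ j * 2 ^ d := by positivity
      rw [abs_sub_comm, abs_of_pos (h3.trans_le h2), div_le_iff₀ (h3.trans_le h2), add_mul]
      have h4 : (2 : ℝ) * 2 ^ j ≤ 4 * 2⁻¹ ^ (d + 1) * (2 ^ (j + 1 + d) - 2 ^ j) := by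
        calc (2 : ℝ) * 2 ^ j = 4 * 2⁻¹ ^ (d + 1) * (2 ^ j * 2 ^ d) := by
              rw [inv_pow, pow_succ]; field_simp; norm_num
          _ ≤ _ := by gcongr
      linarith [hpow j]
    refine (Finset.prod_le_prod (fun i _ => by positivity) h0).trans ?_
    rw [← Real.exp_sum, Real.exp_le_exp, ← Finset.mul_sum]
    have h5 : ∑ i ∈ Finset.Ico (j + 1) N, (2 : ℝ)⁻¹ ^ (i - j)
        ≤ 1 := by
      rw [Finset.sum_Ico_eq_sum_range]
      have h6 : ∀ i, j + 1 + i - j = i + 1 := fun i => by omega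
      simp only [h6]
      have h7 : HasSum (fun i : ℕ => (2 : ℝ)⁻¹ ^ (i + 1)) 1 := by
        simpa [pow_succ, div_eq_mul_inv] using hasSum_geometric_two.mul_right (2 : ℝ)⁻¹
      exact sum_le_hasSum _ (fun i _ => by positivity) h7
    linarith

theorem summable_weightBound (n : ℕ) : Summable fun j => weightBound j * (2 ^ j) ^ n := by
  refine summable_of_ratio_test_tendsto_lt_one (l := 0) zero_lt_one
    (Eventually.of_forall fun j => (mul_pos (weightBound_pos j) (by positivity)).ne') ?_
  have h1 : ∀ j, ‖weightBound (j + 1) * (2 ^ (j + 1)) ^ n‖ / ‖weightBound j * (2 ^ j) ^ n‖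
      = 2 * 2 ^ n * 2⁻¹ ^ j := by
    intro j
    have h2 := weightBound_pos j
    rw [Real.norm_of_nonneg (mul_nonneg (weightBound_pos _).le (by positivity)),
      Real.norm_of_nonneg (mul_nonneg h2.le (by positivity)),
      div_eq_iff (mul_pos h2 (by positivity)).ne']
    have h3 : weightBound (j + 1) = 4 * (2 : ℝ)⁻¹ ^ (j + 1) * weightBound j := by
      rw [weightBound, Finset.prod_range_succ, weightBound]; ring
    rw [h3, pow_succ (2 : ℝ) j, mul_pow]
    ring
  simp only [h1]
  simpa using (tendsto_pow_atTop_nhds_zero_of_lt_one (r := (2 : ℝ)⁻¹) (by norm_num)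
    (by norm_num)).const_mul (2 * 2 ^ n)

/-- Seeley's weights. They are limits, along an ultrafilter, of the interpolation weights, which are
dominated by a summable sequence. -/
theorem exists_isSeeleyWeight : ∃ c, IsSeeleyWeight c := by
  classical
  let e : ℕ → ℕ → ℝ := fun N j => if j < N then lagrangeWeight N j else 0
  have he : ∀ N j, |e N j| ≤ weightBound j := by
    intro N j
    by_cases hj : j < N
    · simpa [e, hj] using abs_lagrangeWeight_le hj
    · simpa [e, hj] using (weightBound_pos j).le
  have hK : IsCompact (Set.pi univ fun j => Icc (-weightBound j) (weightBound j)) :=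
    isCompact_univ_pi fun j => isCompact_Icc
  -- compactness of the product of the intervals replaces convergence of the weights
  let 𝓤 : Ultrafilter ℕ := hyperfilter ℕ
  obtain ⟨c, hcK, hc⟩ := hK.ultrafilter_le_nhds (𝓤.map e) (by
    refine le_principal_iff.2 (Filter.mem_map.2 (Filter.univ_mem' fun N j _ => ?_))
    exact abs_le.1 (he N j))
  have hlim : ∀ j, Tendsto (fun N => e N j) 𝓤 (𝓝 (c j)) := tendsto_pi_nhds.1 hc
  have hcb : ∀ j, |c j| ≤ weightBound j := fun j => abs_le.2 (hcK j (mem_univ j))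
  have hsum : ∀ n : ℕ, Summable fun j => |c j| * (2 ^ j) ^ n := fun n =>
    (summable_weightBound n).of_nonneg_of_le (fun j => by positivity)
      fun j => mul_le_mul_of_nonneg_right (hcb j) (by positivity)
  refine ⟨c, hsum, fun n => ?_⟩
  have hn : ∀ x : ℝ, ∀ j : ℕ, ‖x * (-(2 : ℝ) ^ j) ^ n‖ = |x| * (2 ^ j) ^ n := fun x j => by
    rw [norm_mul, norm_pow, norm_neg, Real.norm_eq_abs, Real.norm_of_nonneg (by positivity)]
  have hs : Summable fun j => c j * (-(2 : ℝ) ^ j) ^ n :=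
    Summable.of_norm ((hsum n).congr fun j => (hn _ _).symm)
  have h1 : Tendsto (fun N => ∑' j, e N j * (-(2 : ℝ) ^ j) ^ n) 𝓤
      (𝓝 (∑' j, c j * (-(2 : ℝ) ^ j) ^ n)) := by
    refine tendsto_tsum_of_dominated_convergence (summable_weightBound n)
      (fun j => (hlim j).mul_const _) (Eventually.of_forall fun N j => ?_)
    rw [hn]
    exact mul_le_mul_of_nonneg_right (he N j) (by positivity)
  have h2 : ∀ᶠ N in (𝓤 : Filter ℕ), ∑' j, e N j * (-(2 : ℝ) ^ j) ^ n = 1 := by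
    have h3 : ∀ᶠ N in (𝓤 : Filter ℕ), n < N :=
      Nat.hyperfilter_le_atTop (eventually_gt_atTop n)
    filter_upwards [h3] with N hN
    rw [tsum_eq_sum (s := Finset.range N) fun j hj => by
      simp [e, show ¬ j < N by simpa using hj], ← sum_lagrangeWeight hN]
    refine Finset.sum_congr rfl fun j hj => ?_
    simp [e, Finset.mem_range.1 hj]
  have h4 : ∑' j, c j * (-(2 : ℝ) ^ j) ^ n = 1 :=
    tendsto_nhds_unique h1 (tendsto_const_nhds.congr' (h2.mono fun N h => h.symm))
  rw [← h4]
  exact hs.hasSum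

end Weights

/-! ### Jets over slabs -/

section Slab

set_option linter.unusedSectionVars false

variable {E : Type u} [AddCommGroup E] [Module ℝ E] [TopologicalSpace E]
  [IsTopologicalAddGroup E] [ContinuousSMul ℝ E]
variable {F : Type v} [AddCommGroup F] [Module ℝ F] [TopologicalSpace F]
  [IsTopologicalAddGroup F] [ContinuousSMul ℝ F]
variable {k : ℕ∞} {a : EReal} {τ b : ℝ} {χ : ℕ → ℝ → ℝ} {P : Omega E}
  {Φ Ψ : ∀ m : ℕ, ℝ × E → (Fin m → ℝ × E) → F}

/-- The jet of `(t, x) ↦ χ 0 t • f (t, x)`, for the jet `Φ` of `f`. -/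
noncomputable def cutJet (χ : ℕ → ℝ → ℝ) (Φ : ∀ m : ℕ, ℝ × E → (Fin m → ℝ × E) → F) (m : ℕ)
    (z : ℝ × E) (w : Fin m → ℝ × E) : F :=
  leibniz χ m 0 z.1 (fun i => Φ i z) w

theorem cutJet_eq_zero (hχ : IsCutoff τ b χ) {m : ℕ} {z : ℝ × E} (hz : z.1 ≤ τ)
    (w : Fin m → ℝ × E) : cutJet χ Φ m z w = 0 :=
  leibniz_eq_zero (fun n => hχ.eq_zero n hz) m 0 _ w

theorem cutJet_eq_self (hχ : IsCutoff τ b χ) {m : ℕ} {z : ℝ × E} (hz : z.1 = b)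
    (w : Fin m → ℝ × E) : cutJet χ Φ m z w = Φ m z w :=
  leibniz_eq_self (by rw [hz, hχ.apply_zero]) (fun n => by rw [hz, hχ.apply_succ]) m _ w

/-- Multiplication with a cutoff function makes a jet over `(a, b] × V̆` extend by zero to a jet
over `(-∞, b] × V̆`. -/
theorem IsJet.isJet_cutJet (haτ : a < τ) (hab : a < b) (hχ : IsCutoff τ b χ)
    (h : IsJet k (P.slab a b hab) Φ) :
    IsJet k (P.slab ⊥ b (EReal.bot_lt_coe b)) (cutJet χ Φ) := by
  obtain ⟨μ, hμ, h0⟩ := hχ.exists_eq_zero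
  have hz0 : ∀ {z : ℝ × E}, z.1 < μ → ∀ m w, cutJet χ Φ m z w = 0 := fun {z} hz m w =>
    leibniz_eq_zero (fun n => h0 n _ hz) m 0 _ w
  have hat : ∀ {t : ℝ}, τ < t → a < (t : EReal) := fun {t} ht =>
    haτ.trans (EReal.coe_lt_coe_iff.2 ht)
  refine ⟨fun m hm => ?_, fun m hm w z hz v => ?_⟩
  · have h1 : ContinuousOn (fun q : (ℝ × E) × (Fin m → ℝ × E) => cutJet χ Φ m q.1 q.2)
        ((P.slab a b hab).outer ×ˢ univ) :=
      continuousOn_leibniz hχ.continuous m (t := fun z : ℝ × E => z.1)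
        (Ψ := fun z i => Φ i z) (by fun_prop)
        (fun i hi => h.continuousOn i (le_trans (by exact_mod_cast hi) hm)) 0
    intro q hq
    rcases lt_or_ge q.1.1 μ with hqμ | hqμ
    · have h2 : ∀ᶠ q' : (ℝ × E) × (Fin m → ℝ × E) in 𝓝 q, q'.1.1 < μ :=
        (isOpen_lt (f := fun q' : (ℝ × E) × (Fin m → ℝ × E) => q'.1.1) (by fun_prop)
          continuous_const).mem_nhds hqμ
      have h3 : (fun _ => (0 : F)) =ᶠ[𝓝 q]
          fun q : (ℝ × E) × (Fin m → ℝ × E) => cutJet χ Φ m q.1 q.2 := by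
        filter_upwards [h2] with q' hq'
        exact (hz0 hq' m q'.2).symm
      exact (continuousAt_const.congr h3).continuousWithinAt
    · have hqτ : τ < q.1.1 := hμ.trans_le hqμ
      have h2 : {q' : (ℝ × E) × (Fin m → ℝ × E) | τ < q'.1.1} ∈ 𝓝 q :=
        (isOpen_lt (g := fun q' : (ℝ × E) × (Fin m → ℝ × E) => q'.1.1) continuous_const
          (by fun_prop)).mem_nhds hqτ
      refine (h1 q ⟨⟨⟨hat hqτ, hq.1.1.2⟩, hq.1.2⟩, mem_univ _⟩).mono_of_mem_nhdsWithin ?_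
      filter_upwards [mem_nhdsWithin_of_mem_nhds h2, self_mem_nhdsWithin] with q' h3 h4
      exact ⟨⟨⟨hat h3, h4.1.1.2⟩, h4.1.2⟩, mem_univ _⟩
  · rcases lt_or_ge z.1 μ with hzμ | hzμ
    · rw [hz0 hzμ]
      refine (hasDirDeriv_const (0 : F) z v).congr_of_eventuallyEq ?_
      have h2 : ∀ᶠ z' : ℝ × E in 𝓝 z, z'.1 < μ :=
        (isOpen_lt continuous_fst continuous_const).mem_nhds hzμ
      filter_upwards [h2] with z' hz'
      exact (hz0 hz' m w).symm
    · refine hasDirDeriv_leibniz hχ.hasDerivAt m (Ψ := fun z i => Φ i z) (fun i hi u => ?_) 0 w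
      refine h.hasDirDeriv i (le_trans ?_ hm) u z ⟨⟨hat (hμ.trans_le hzμ), hz.1.2⟩, hz.2⟩ v
      exact_mod_cast Nat.succ_le_succ hi

/-- Differentials at a point of the slab, expanded along the decomposition
`(r, X) = r • (1, 0) + (0, X)` of each direction. -/
theorem IsJet.apply_eq_sum [LocallyConvexSpace ℝ F] [T2Space F] {Q : Omega (ℝ × E)}
    (h : IsJet k Q Φ) {m : ℕ}
    (hm : (m : ℕ∞) ≤ k) {z : ℝ × E} (hz : z ∈ Q.outer) (w : Fin m → ℝ × E) :
    Φ m z w = ∑ S : Finset (Fin m), (∏ i ∈ S, (w i).1) •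
      Φ m z (S.piecewise (fun _ => (1, 0)) fun i => (0, (w i).2)) := by
  obtain ⟨M, hM⟩ := h.exists_multilinearMap hm hz
  have h1 : w = (fun i => (w i).1 • ((1, 0) : ℝ × E)) + fun i => (0, (w i).2) := by
    ext i : 1
    simp
  have h2 := M.map_add_univ (fun i => (w i).1 • ((1, 0) : ℝ × E)) fun i => (0, (w i).2)
  rw [← h1, hM] at h2
  rw [h2]
  refine Finset.sum_congr rfl fun S _ => ?_
  have h3 := M.map_piecewise_smul (fun i => (w i).1)
    (S.piecewise (fun _ => ((1, 0) : ℝ × E)) fun i => (0, (w i).2)) S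
  rw [← hM, ← h3]
  congr 1
  ext i : 1
  by_cases hi : i ∈ S <;> simp [hi]

theorem continuous_piecewise_frame {m : ℕ} (S : Finset (Fin m)) :
    Continuous fun w : Fin m → ℝ × E =>
      (S.piecewise (fun _ => (1, 0)) fun i => (0, (w i).2) : Fin m → ℝ × E) := by
  refine continuous_pi fun i => ?_
  by_cases hi : i ∈ S
  · simp only [Finset.piecewise, hi, if_true]
    fun_prop
  · simp only [Finset.piecewise, hi, if_false]
    fun_prop

/-! ### The reflected series -/

/-- The reflections `(t, x) ↦ (b - 2ʲ (t - b), x)`. -/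
def reflPoint (b : ℝ) (j : ℕ) (z : ℝ × E) : ℝ × E := (b - 2 ^ j * (z.1 - b), z.2)

/-- The linear parts `(r, X) ↦ (-2ʲ r, X)` of the reflections `reflPoint`. -/
def reflDir (j : ℕ) (v : ℝ × E) : ℝ × E := (-2 ^ j * v.1, v.2)

/-- The jet of the series `∑ⱼ cⱼ • g (b - 2ʲ (t - b), x)`, for the jet `Ψ` of `g`. -/
noncomputable def reflJet (c : ℕ → ℝ) (b : ℝ) (Ψ : ∀ m : ℕ, ℝ × E → (Fin m → ℝ × E) → F) (m : ℕ)
    (z : ℝ × E) (w : Fin m → ℝ × E) : F :=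
  ∑' j, c j • Ψ m (reflPoint b j z) fun i => reflDir j (w i)

theorem continuous_reflPoint (b : ℝ) (j : ℕ) : Continuous (reflPoint b j : ℝ × E → ℝ × E) := by
  unfold reflPoint; fun_prop

theorem continuous_reflDir (j : ℕ) : Continuous (reflDir j : ℝ × E → ℝ × E) := by
  unfold reflDir; fun_prop

theorem reflPoint_fst_le {j : ℕ} {z : ℝ × E} (hz : b ≤ z.1) : (reflPoint b j z).1 ≤ b := by
  have : 0 ≤ 2 ^ j * (z.1 - b) := mul_nonneg (by positivity) (by linarith)
  simp only [reflPoint]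
  linarith

theorem reflPoint_fst_lt {j : ℕ} {z : ℝ × E} (hz : b < z.1) : (reflPoint b j z).1 < b := by
  have : 0 < 2 ^ j * (z.1 - b) := mul_pos (by positivity) (by linarith)
  simp only [reflPoint]
  linarith

theorem reflPoint_fst_le_of_le {j : ℕ} {z : ℝ × E} (hτb : τ < b) (hz : 2 * b - τ ≤ z.1) :
    (reflPoint b j z).1 ≤ τ := by
  have h1 : (1 : ℝ) ≤ 2 ^ j := one_le_pow₀ (by norm_num)
  simp only [reflPoint]
  nlinarith

theorem exists_reflPoint_fst_le (τ : ℝ) {t : ℝ} (ht : b < t) :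
    ∃ N : ℕ, ∀ j ≥ N, ∀ z : ℝ × E, t ≤ z.1 → (reflPoint b j z).1 ≤ τ := by
  obtain ⟨N, hN⟩ := pow_unbounded_of_one_lt ((b - τ) / (t - b)) (one_lt_two (α := ℝ))
  refine ⟨N, fun j hj z hz => ?_⟩
  rw [div_lt_iff₀ (by linarith)] at hN
  have h1 : (2 : ℝ) ^ N ≤ 2 ^ j := pow_le_pow_right₀ (by norm_num) hj
  have h2 : (2 : ℝ) ^ N * (t - b) ≤ 2 ^ j * (z.1 - b) :=
    mul_le_mul h1 (by linarith) (by linarith) (by positivity)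
  simp only [reflPoint]
  linarith

/-- The reflected series is a finite sum, uniformly for `t` away from `b`. -/
theorem exists_reflJet_eq_sum (c : ℕ → ℝ) (τ : ℝ) {t : ℝ} (ht : b < t) :
    ∃ N : ℕ, ∀ {Ψ : ∀ m : ℕ, ℝ × E → (Fin m → ℝ × E) → F}, (∀ m z w, z.1 ≤ τ → Ψ m z w = 0) →
      ∀ z : ℝ × E, t ≤ z.1 → ∀ m w, reflJet c b Ψ m z w =
        ∑ j ∈ Finset.range N, c j • Ψ m (reflPoint b j z) fun i => reflDir j (w i) := by
  obtain ⟨N, hN⟩ := exists_reflPoint_fst_le (E := E) τ ht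
  refine ⟨N, fun {Ψ} hΨ z hz m w => tsum_eq_sum fun j hj => ?_⟩
  rw [hΨ _ _ _ (hN j (by simpa using hj) z hz), smul_zero]

theorem HasDirDeriv.comp_refl {g : ℝ × E → F} {j : ℕ} {z v : ℝ × E} {y : F}
    (h : HasDirDeriv g y (reflPoint b j z) (reflDir j v)) :
    HasDirDeriv (fun x => g (reflPoint b j x)) y z v := by
  refine h.congr fun t => ?_
  congr 3
  ext
  · simp [reflPoint, reflDir]; ring
  · simp [reflPoint, reflDir]

/-- Term by term differentiation of the reflected series, which is locally a finite sum. -/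
theorem IsJet.hasDirDeriv_reflJet (c : ℕ → ℝ) (h : IsJet k (P.slab ⊥ b (EReal.bot_lt_coe b)) Ψ)
    (hΨ : ∀ m z w, z.1 ≤ τ → Ψ m z w = 0) {m : ℕ} (hm : ((m + 1 : ℕ) : ℕ∞) ≤ k)
    (w : Fin m → ℝ × E) {z : ℝ × E} (hz : b < z.1) (hzP : z.2 ∈ P.inner) (v : ℝ × E) :
    HasDirDeriv (fun y => reflJet c b Ψ m y w) (reflJet c b Ψ (m + 1) z (Fin.snoc w v)) z v := by
  obtain ⟨t, hbt, htz⟩ := exists_between hz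
  obtain ⟨N, hN'⟩ := exists_reflJet_eq_sum (E := E) (F := F) c τ hbt
  have hN := hN' hΨ
  rw [hN z htz.le]
  have h1 : HasDirDeriv (fun y => ∑ j ∈ Finset.range N, c j • Ψ m (reflPoint b j y)
      fun i => reflDir j (w i)) (∑ j ∈ Finset.range N, c j • Ψ (m + 1) (reflPoint b j z)
        fun i => reflDir j ((Fin.snoc w v : Fin (m + 1) → ℝ × E) i)) z v := by
    refine HasDirDeriv.sum _ fun j _ => HasDirDeriv.const_smul (HasDirDeriv.comp_refl
      (g := fun y => Ψ m y fun i => reflDir j (w i)) ?_) _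
    have h2 := h.hasDirDeriv m hm (fun i => reflDir j (w i)) (reflPoint b j z)
      ⟨⟨EReal.bot_lt_coe _, EReal.coe_lt_coe_iff.2 (reflPoint_fst_lt hz)⟩, hzP⟩ (reflDir j v)
    convert! h2 using 2
    ext i : 1
    refine Fin.lastCases ?_ (fun i => ?_) i <;> simp
  refine h1.congr_of_eventuallyEq ?_
  have h3 : ∀ᶠ y : ℝ × E in 𝓝 z, t < y.1 :=
    (isOpen_lt continuous_const continuous_fst).mem_nhds htz
  filter_upwards [h3] with y hy
  exact (hN y hy.le m w).symm

theorem mapsTo_refl (j : ℕ) {m : ℕ} : MapsTo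
    (fun q : (ℝ × E) × (Fin m → ℝ × E) => (reflPoint b j q.1, fun i => reflDir j (q.2 i)))
    ((Ici b ×ˢ P.outer) ×ˢ univ) ((P.slab ⊥ b (EReal.bot_lt_coe b)).outer ×ˢ univ) :=
  fun _ hq => ⟨⟨⟨EReal.bot_lt_coe _, EReal.coe_le_coe_iff.2 (reflPoint_fst_le hq.1.1)⟩, hq.1.2⟩,
    mem_univ _⟩

theorem IsJet.continuousOn_reflJet (c : ℕ → ℝ) (h : IsJet k (P.slab ⊥ b (EReal.bot_lt_coe b)) Ψ)
    (hΨ : ∀ m z w, z.1 ≤ τ → Ψ m z w = 0) {m : ℕ} (hm : (m : ℕ∞) ≤ k) :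
    ContinuousOn (fun q : (ℝ × E) × (Fin m → ℝ × E) => reflJet c b Ψ m q.1 q.2)
      ((Ioi b ×ˢ P.outer) ×ˢ univ) := by
  intro q hq
  obtain ⟨t, hbt, htq⟩ := exists_between (show b < q.1.1 from hq.1.1)
  obtain ⟨N, hN'⟩ := exists_reflJet_eq_sum (E := E) (F := F) c τ hbt
  have hN := hN' hΨ
  have h1 : ContinuousOn (fun q : (ℝ × E) × (Fin m → ℝ × E) => ∑ j ∈ Finset.range N,
      c j • Ψ m (reflPoint b j q.1) fun i => reflDir j (q.2 i)) ((Ici b ×ˢ P.outer) ×ˢ univ) := by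
    refine continuousOn_finsetSum _ fun j _ => ContinuousOn.const_smul ?_ _
    refine (h.continuousOn m hm).comp (Continuous.continuousOn ?_) (mapsTo_refl j)
    exact ((continuous_reflPoint b j).comp continuous_fst).prodMk (continuous_pi fun i =>
      (continuous_reflDir j).comp ((continuous_apply i).comp continuous_snd))
  have h3 : ∀ᶠ q' : (ℝ × E) × (Fin m → ℝ × E) in 𝓝 q, t < q'.1.1 :=
    (isOpen_lt (g := fun q' : (ℝ × E) × (Fin m → ℝ × E) => q'.1.1) continuous_const
      (by fun_prop)).mem_nhds htq
  refine (((h1 q ⟨⟨(le_of_lt hq.1.1 : b ≤ q.1.1), hq.1.2⟩, mem_univ _⟩).mono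
    (prod_mono (prod_mono Ioi_subset_Ici_self subset_rfl) subset_rfl)).congr_of_eventuallyEq
    ?_ ?_)
  · filter_upwards [mem_nhdsWithin_of_mem_nhds h3] with q' hq'
    exact hN _ (le_of_lt hq') m _
  · exact hN _ htq.le m _

end Slab

section Extension

set_option linter.unusedSectionVars false

variable {E : Type u} [AddCommGroup E] [Module ℝ E] [TopologicalSpace E]
  [IsTopologicalAddGroup E] [ContinuousSMul ℝ E]
variable {F : Type v} [AddCommGroup F] [Module ℝ F] [TopologicalSpace F]
  [IsTopologicalAddGroup F] [ContinuousSMul ℝ F]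
variable {k : ℕ∞} {a : EReal} {τ b : ℝ} {χ : ℕ → ℝ → ℝ} {c : ℕ → ℝ} {P : Omega E}
  {Φ Ψ : ∀ m : ℕ, ℝ × E → (Fin m → ℝ × E) → F}

/-- The reflected series converges, as `t → b`, to the value of the jet at `t = b`. Expanding the
differentials along `ℝ × {0}` and `{0} × E`, this is Tannery's theorem together with the moment
conditions. -/
theorem IsJet.tendsto_reflJet [LocallyConvexSpace ℝ F] [T2Space F] (hc : IsSeeleyWeight c)
    (h : IsJet k (P.slab ⊥ b (EReal.bot_lt_coe b)) Ψ)
    (hΨ : ∀ m z w, z.1 ≤ τ → Ψ m z w = 0) {m : ℕ} (hm : (m : ℕ∞) ≤ k) {z : ℝ × E} (hzb : z.1 = b)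
    (hzP : z.2 ∈ P.outer) (w : Fin m → ℝ × E) :
    Tendsto (fun q : (ℝ × E) × (Fin m → ℝ × E) => reflJet c b Ψ m q.1 q.2)
      (𝓝[(Ioi b ×ˢ P.outer) ×ˢ univ] (z, w)) (𝓝 (Ψ m z w)) := by
  have hz : z ∈ (P.slab ⊥ b (EReal.bot_lt_coe b)).outer :=
    ⟨⟨EReal.bot_lt_coe _, EReal.coe_le_coe_iff.2 hzb.le⟩, hzP⟩
  have hmem : ∀ {q : (ℝ × E) × (Fin m → ℝ × E)}, q ∈ (Ioi b ×ˢ P.outer) ×ˢ univ → ∀ j,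
      reflPoint b j q.1 ∈ (P.slab ⊥ b (EReal.bot_lt_coe b)).outer := fun {q} hq j =>
    ⟨⟨EReal.bot_lt_coe _, EReal.coe_le_coe_iff.2 (reflPoint_fst_lt hq.1.1).le⟩, hq.1.2⟩
  -- the values of `Ψ m` at the reflected points, on the frames `(1, 0)`, `(0, X)`
  let g : Finset (Fin m) → ℕ → (ℝ × E) × (Fin m → ℝ × E) → F := fun S j q =>
    Ψ m (reflPoint b j q.1) (S.piecewise (fun _ => (1, 0)) fun i => (0, (q.2 i).2))
  have hΨc := h.continuousOn m hm
  have key : ∀ S : Finset (Fin m), Tendsto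
      (fun q => ∑' j, (c j * (-(2 : ℝ) ^ j) ^ S.card) • g S j q)
      (𝓝[(Ioi b ×ˢ P.outer) ×ˢ univ] (z, w))
      (𝓝 ((1 : ℝ) • Ψ m z (S.piecewise (fun _ => (1, 0)) fun i => (0, (w i).2)))) := by
    intro S
    refine tendsto_tsum_smul ((hc.summable S.card).congr fun j => ?_) (hc.hasSum S.card)
      (fun j => ?_) (fun p hp => ?_) ?_
    · rw [abs_mul, abs_pow, abs_neg, abs_of_pos (by positivity : (0 : ℝ) < 2 ^ j)]
    · have h1 : Continuous fun q : (ℝ × E) × (Fin m → ℝ × E) => (reflPoint b j q.1,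
          (S.piecewise (fun _ => (1, 0)) fun i => (0, (q.2 i).2) : Fin m → ℝ × E)) :=
        ((continuous_reflPoint b j).comp continuous_fst).prodMk
          ((continuous_piecewise_frame S).comp continuous_snd)
      have h2 := h1.continuousWithinAt.tendsto_nhdsWithin
        (s := (Ioi b ×ˢ P.outer) ×ˢ univ) (x := (z, w))
        (t := (P.slab ⊥ b (EReal.bot_lt_coe b)).outer ×ˢ univ)
        fun q hq => ⟨hmem hq j, mem_univ _⟩
      have h3 : reflPoint b j z = z := by
        ext <;> simp [reflPoint, hzb]
      rw [h3] at h2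
      exact Tendsto.comp (hΨc (z, _) ⟨hz, mem_univ _⟩) h2
    · have h1 : Continuous fun y : ℝ × (E × (Fin m → ℝ × E)) => ((y.1, y.2.1),
          (S.piecewise (fun _ => (1, 0)) fun i => (0, (y.2.2 i).2) : Fin m → ℝ × E)) :=
        (by fun_prop : Continuous fun y : ℝ × (E × (Fin m → ℝ × E)) => (y.1, y.2.1)).prodMk
          ((continuous_piecewise_frame S).comp (by fun_prop))
      have h2 : ContinuousOn (fun y : ℝ × (E × (Fin m → ℝ × E)) => p (Ψ m (y.1, y.2.1)
          (S.piecewise (fun _ => (1, 0)) fun i => (0, (y.2.2 i).2))))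
          (Icc τ b ×ˢ (P.outer ×ˢ univ)) :=
        hp.comp_continuousOn (hΨc.comp h1.continuousOn fun y hy =>
          ⟨⟨⟨EReal.bot_lt_coe _, EReal.coe_le_coe_iff.2 hy.1.2⟩, hy.2.1⟩, mem_univ _⟩)
      obtain ⟨M, hM⟩ := isCompact_Icc.exists_eventually_le_of_continuousOn h2
        (y := (z.2, w)) ⟨hzP, mem_univ _⟩
      refine ⟨max M 0, ?_⟩
      have h4 : Continuous fun q : (ℝ × E) × (Fin m → ℝ × E) => (q.1.2, q.2) := by fun_prop
      have h5 := h4.continuousWithinAt.tendsto_nhdsWithin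
        (s := (Ioi b ×ˢ P.outer) ×ˢ univ) (x := (z, w)) (t := P.outer ×ˢ univ)
        fun q hq => ⟨hq.1.2, mem_univ _⟩
      filter_upwards [h5.eventually hM, self_mem_nhdsWithin] with q hq hqs j
      rcases le_total (reflPoint b j q.1).1 τ with hτ | hτ
      · simp only [g]
        rw [hΨ _ _ _ hτ, map_zero]
        exact le_max_right _ _
      · exact (hq _ ⟨hτ, (reflPoint_fst_lt hqs.1.1).le⟩).trans (le_max_left _ _)
    · filter_upwards [self_mem_nhdsWithin] with q hq
      obtain ⟨N, hN⟩ := exists_reflPoint_fst_le (E := E) τ (show b < q.1.1 from hq.1.1)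
      exact ⟨N, fun j hj => hΨ _ _ _ (hN j hj q.1 le_rfl)⟩
  have hsum : Tendsto (fun q : (ℝ × E) × (Fin m → ℝ × E) => ∑ S : Finset (Fin m),
      (∏ i ∈ S, (q.2 i).1) • ∑' j, (c j * (-(2 : ℝ) ^ j) ^ S.card) • g S j q)
      (𝓝[(Ioi b ×ˢ P.outer) ×ˢ univ] (z, w)) (𝓝 (Ψ m z w)) := by
    rw [h.apply_eq_sum hm hz w]
    refine tendsto_finsetSum _ fun S _ => ?_
    have h1 := key S
    rw [one_smul] at h1
    refine Tendsto.smul ?_ h1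
    have h2 : Continuous fun q : (ℝ × E) × (Fin m → ℝ × E) => ∏ i ∈ S, (q.2 i).1 := by fun_prop
    exact (h2.tendsto (z, w)).mono_left nhdsWithin_le_nhds
  refine hsum.congr' ?_
  filter_upwards [self_mem_nhdsWithin] with q hq
  obtain ⟨N, hN⟩ := exists_reflPoint_fst_le (E := E) τ (show b < q.1.1 from hq.1.1)
  have hN' : ∀ j ∉ Finset.range N, ∀ w, Ψ m (reflPoint b j q.1) w = 0 := fun j hj w =>
    hΨ _ _ _ (hN j (by simpa using hj) q.1 le_rfl)
  have h1 : ∀ S : Finset (Fin m), ∑' j, (c j * (-(2 : ℝ) ^ j) ^ S.card) • g S j q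
      = ∑ j ∈ Finset.range N, (c j * (-(2 : ℝ) ^ j) ^ S.card) • g S j q := fun S =>
    tsum_eq_sum fun j hj => by simp only [g]; rw [hN' j hj, smul_zero]
  rw [reflJet, tsum_eq_sum (s := Finset.range N) fun j hj => by rw [hN' j hj, smul_zero]]
  simp only [h1, Finset.smul_sum]
  rw [Finset.sum_comm]
  refine Finset.sum_congr rfl fun j _ => ?_
  rw [h.apply_eq_sum hm (hmem hq j) (fun i => reflDir j (q.2 i)), Finset.smul_sum]
  refine Finset.sum_congr rfl fun S _ => ?_
  simp only [reflDir, g, Finset.prod_mul_distrib, Finset.prod_const, smul_smul]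
  congr 1
  ring

/-! ### The extended jet -/

/-- The jet `Φ` for `t ≤ b`, continued by the reflected series of its cut off version. -/
noncomputable def extJet (c : ℕ → ℝ) (χ : ℕ → ℝ → ℝ) (b : ℝ)
    (Φ : ∀ m : ℕ, ℝ × E → (Fin m → ℝ × E) → F) (m : ℕ) (z : ℝ × E) (w : Fin m → ℝ × E) : F :=
  open Classical in if z.1 ≤ b then Φ m z w else reflJet c b (cutJet χ Φ) m z w

theorem extJet_of_le {m : ℕ} {z : ℝ × E} (hz : z.1 ≤ b) (w : Fin m → ℝ × E) :
    extJet c χ b Φ m z w = Φ m z w := if_pos hz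

theorem extJet_of_lt {m : ℕ} {z : ℝ × E} (hz : b < z.1) (w : Fin m → ℝ × E) :
    extJet c χ b Φ m z w = reflJet c b (cutJet χ Φ) m z w := if_neg hz.not_ge

theorem extJet_eq_zero (hχ : IsCutoff τ b χ) (hτb : τ < b) {m : ℕ} {z : ℝ × E}
    (hz : 2 * b - τ ≤ z.1) (w : Fin m → ℝ × E) : extJet c χ b Φ m z w = 0 := by
  rw [extJet_of_lt (by linarith), reflJet]
  simp only [cutJet_eq_zero hχ (reflPoint_fst_le_of_le hτb hz), smul_zero, tsum_zero]

theorem IsJet.continuousOn_extJet [LocallyConvexSpace ℝ F] [T2Space F] (hc : IsSeeleyWeight c)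
    (hχ : IsCutoff τ b χ) (haτ : a < τ) (hab : a < b) (h : IsJet k (P.slab a b hab) Φ) {m : ℕ}
    (hm : (m : ℕ∞) ≤ k) :
    ContinuousOn (fun q : (ℝ × E) × (Fin m → ℝ × E) => extJet c χ b Φ m q.1 q.2)
      ((P.slab a ⊤ (haτ.trans_le le_top)).outer ×ˢ univ) := by
  have hΨ := h.isJet_cutJet haτ hab hχ
  have hΨ0 : ∀ m (z : ℝ × E) w, z.1 ≤ τ → cutJet χ Φ m z w = 0 := fun m z w hz =>
    cutJet_eq_zero hχ hz w
  intro q hq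
  have hcover : (P.slab a ⊤ (haτ.trans_le le_top)).outer ×ˢ (univ : Set (Fin m → ℝ × E))
      ⊆ (P.slab a b hab).outer ×ˢ univ ∪ (Ioi b ×ˢ P.outer) ×ˢ univ := by
    rintro q' hq'
    rcases le_or_gt q'.1.1 b with hb | hb
    · exact Or.inl ⟨⟨⟨hq'.1.1.1, EReal.coe_le_coe_iff.2 hb⟩, hq'.1.2⟩, mem_univ _⟩
    · exact Or.inr ⟨⟨hb, hq'.1.2⟩, mem_univ _⟩
  refine ContinuousWithinAt.mono (ContinuousWithinAt.union ?_ ?_) hcover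
  · rcases le_or_gt q.1.1 b with hb | hb
    · refine (h.continuousOn m hm q
        ⟨⟨⟨hq.1.1.1, EReal.coe_le_coe_iff.2 hb⟩, hq.1.2⟩, mem_univ _⟩).congr (fun q' hq' => ?_) ?_
      · exact extJet_of_le (EReal.coe_le_coe_iff.1 hq'.1.1.2) _
      · exact extJet_of_le hb _
    · refine continuousWithinAt_of_notMem_closure fun hcl => ?_
      have h1 : IsClosed {q' : (ℝ × E) × (Fin m → ℝ × E) | q'.1.1 ≤ b} :=
        isClosed_le (by fun_prop) continuous_const
      exact hb.not_ge (closure_minimal (fun q' hq' => EReal.coe_le_coe_iff.1 hq'.1.1.2) h1 hcl)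
  · have heq : ∀ q' ∈ (Ioi b ×ˢ P.outer) ×ˢ (univ : Set (Fin m → ℝ × E)),
        extJet c χ b Φ m q'.1 q'.2 = reflJet c b (cutJet χ Φ) m q'.1 q'.2 :=
      fun q' hq' => extJet_of_lt hq'.1.1 _
    rcases lt_trichotomy q.1.1 b with hb | hb | hb
    · refine continuousWithinAt_of_notMem_closure fun hcl => ?_
      have h1 : IsClosed {q' : (ℝ × E) × (Fin m → ℝ × E) | b ≤ q'.1.1} :=
        isClosed_le continuous_const (by fun_prop)
      exact hb.not_ge (closure_minimal (fun q' hq' => (le_of_lt hq'.1.1 : b ≤ q'.1.1)) h1 hcl)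
    · have h1 := hΨ.tendsto_reflJet hc hΨ0 hm hb hq.1.2 q.2
      rw [cutJet_eq_self hχ hb, ← extJet_of_le (c := c) (χ := χ) (Φ := Φ) hb.le q.2] at h1
      refine h1.congr' ?_
      filter_upwards [self_mem_nhdsWithin] with q' hq'
      exact (heq q' hq').symm
    · exact (hΨ.continuousOn_reflJet c hΨ0 hm q ⟨⟨hb, hq.1.2⟩, mem_univ _⟩).congr heq
        (extJet_of_lt hb _)

/-- The extended jet is a jet. At the points with `t = b`, its differentiability follows from
its differentiability for `t ≠ b` and the continuity of the differentials. -/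
theorem IsJet.isJet_extJet [LocallyConvexSpace ℝ F] [T2Space F] (hc : IsSeeleyWeight c)
    (hχ : IsCutoff τ b χ) (haτ : a < τ) (hab : a < b) (h : IsJet k (P.slab a b hab) Φ) :
    IsJet k (P.slab a ⊤ (haτ.trans_le le_top)) (extJet c χ b Φ) := by
  refine ⟨fun m hm => h.continuousOn_extJet hc hχ haτ hab hm, fun m hm w z hz v => ?_⟩
  have hoff : ∀ y ∈ (P.slab a ⊤ (haτ.trans_le le_top)).inner, y.1 ≠ b → HasDirDeriv
      (fun y => extJet c χ b Φ m y w)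
      (extJet c χ b Φ (m + 1) y (Fin.snoc w v)) y v := by
    intro y hy hyb
    rcases lt_or_gt_of_ne hyb with hb | hb
    · rw [extJet_of_le hb.le]
      refine (h.hasDirDeriv m hm w y ⟨⟨hy.1.1, EReal.coe_lt_coe_iff.2 hb⟩, hy.2⟩
        v).congr_of_eventuallyEq ?_
      have h2 : ∀ᶠ y' : ℝ × E in 𝓝 y, y'.1 < b :=
        (isOpen_lt continuous_fst continuous_const).mem_nhds hb
      filter_upwards [h2] with y' hy'
      exact (extJet_of_le (le_of_lt hy') w).symm
    · rw [extJet_of_lt hb]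
      refine ((h.isJet_cutJet haτ hab hχ).hasDirDeriv_reflJet c
        (fun m z w hz => cutJet_eq_zero hχ hz w) hm w hb hy.2 v).congr_of_eventuallyEq ?_
      have h2 : ∀ᶠ y' : ℝ × E in 𝓝 y, b < y'.1 :=
        (isOpen_lt continuous_const continuous_fst).mem_nhds hb
      filter_upwards [h2] with y' hy'
      exact (extJet_of_lt hy' w).symm
  by_cases hzb : z.1 = b
  · have hsub := (P.slab a ⊤ (haτ.trans_le le_top)).inner_subset_outer
    have hopen := (P.slab a ⊤ (haτ.trans_le le_top)).isOpen_inner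
    have hcont : ∀ (n : ℕ), (n : ℕ∞) ≤ k → ∀ w : Fin n → ℝ × E, ContinuousOn
        (fun y => extJet c χ b Φ n y w)
        (P.slab a ⊤ (haτ.trans_le le_top)).inner := fun n hn w =>
      (h.continuousOn_extJet hc hχ haτ hab hn).comp (f := fun y => (y, w)) (by fun_prop)
        fun y hy => ⟨hsub hy, mem_univ _⟩
    refine hasDirDeriv_of_hyperplane hopen
      (D := fun y => extJet c χ b Φ (m + 1) y (Fin.snoc w v)) hz
      (ContinuousLinearMap.fst ℝ ℝ E) ?_ (hcont m (natCast_le_of_succ_le hm) w)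
      (fun y hy hyb => hoff y hy ?_) ((hcont (m + 1) hm _).continuousAt (hopen.mem_nhds hz))
    · intro h0
      have := congrArg (fun φ : StrongDual ℝ (ℝ × E) => φ (1, 0)) h0
      simp at this
    · rw [← hzb]
      exact hyb
  · exact hoff z hz hzb

end Extension

/-! ### Estimates -/

section Estimates

set_option linter.unusedSectionVars false

/-- The differentials are bounded on `K × Bᵐ` for `K` compact and `B` merely bounded: near `K × {0}`
they are bounded by continuity, and `B` is absorbed by a neighbourhood of zero. -/
theorem IsJet.exists_seminorm_le {H : Type*} [AddCommGroup H] [Module ℝ H] [TopologicalSpace H]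
    [IsTopologicalAddGroup H] [ContinuousSMul ℝ H]
    {F : Type*} [AddCommGroup F] [Module ℝ F] [TopologicalSpace F]
    [IsTopologicalAddGroup F] [ContinuousSMul ℝ F] [LocallyConvexSpace ℝ F] [T2Space F]
    {k : ℕ∞} {P : Omega H} {Φ : ∀ m : ℕ, H → (Fin m → H) → F} (h : IsJet k P Φ)
    {p : Seminorm ℝ F} (hp : Continuous p) {K : Set H} (hK : IsCompact K) (hKP : K ⊆ P.outer)
    {B : Set H} (hB : Bornology.IsVonNBounded ℝ B) {m : ℕ} (hm : (m : ℕ∞) ≤ k) :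
    ∃ M : ℝ, ∀ z ∈ K, ∀ w : Fin m → H, (∀ i, w i ∈ B) → p (Φ m z w) ≤ M := by
  obtain ⟨M, hM⟩ := hK.exists_eventually_le_of_continuousOn
    (g := fun q : H × (Fin m → H) => p (Φ m q.1 q.2)) (A := univ)
    (hp.comp_continuousOn ((h.continuousOn m hm).mono (prod_mono hKP subset_rfl)))
    (y := 0) (mem_univ _)
  rw [nhdsWithin_univ] at hM
  have hpi : Bornology.IsVonNBounded ℝ (Set.pi univ fun _ : Fin m => B) :=
    Bornology.isVonNBounded_pi_iff.2 fun i => hB.subset <| by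
      rintro _ ⟨w, hw, rfl⟩
      exact hw i (mem_univ i)
  obtain ⟨r, hr⟩ := (hpi hM).exists_pos
  refine ⟨r ^ m * M, fun z hz w hw => ?_⟩
  obtain ⟨w', hw', rfl⟩ := hr.2 r (le_abs_self r) (show w ∈ Set.pi univ fun _ => B from
    fun i _ => hw i)
  obtain ⟨L, hL⟩ := h.exists_multilinearMap hm (hKP hz)
  have h1 := L.map_smul_univ (fun _ => r) w'
  rw [Finset.prod_const, Finset.card_univ, Fintype.card_fin, hL, hL] at h1
  have h2 : Φ m z (r • w') = r ^ m • Φ m z w' := h1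
  simp only
  rw [h2, map_smul_eq_mul, Real.norm_of_nonneg (pow_nonneg hr.1.le m)]
  exact mul_le_mul_of_nonneg_left (hw' z hz) (pow_nonneg hr.1.le m)

variable {E : Type u} [AddCommGroup E] [Module ℝ E] [TopologicalSpace E]
  [IsTopologicalAddGroup E] [ContinuousSMul ℝ E]
variable {F : Type v} [AddCommGroup F] [Module ℝ F] [TopologicalSpace F]
  [IsTopologicalAddGroup F] [ContinuousSMul ℝ F]
variable {k : ℕ∞} {a : EReal} {τ b : ℝ} {χ : ℕ → ℝ → ℝ} {c : ℕ → ℝ} {P : Omega E}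
  {Φ : ∀ m : ℕ, ℝ × E → (Fin m → ℝ × E) → F}

theorem isVonNBounded_boundFrame {B : Set E} (hB : Bornology.IsVonNBounded ℝ B) :
    Bornology.IsVonNBounded ℝ (boundFrame B) := by
  refine (Bornology.isVonNBounded_singleton _).union
    ((hB.image (ContinuousLinearMap.inr ℝ ℝ E)).subset ?_)
  rintro ⟨r, x⟩ ⟨hr, hx⟩
  exact ⟨x, hx, by simp [show r = 0 from hr]⟩

theorem slab_mem_outer {hab : a < b} (haτ : a < τ) {t : ℝ} {x : E} (ht : t ∈ Icc τ b)
    (hx : x ∈ P.outer) : ((t, x) : ℝ × E) ∈ (P.slab a b hab).outer :=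
  ⟨⟨haτ.trans_le (EReal.coe_le_coe_iff.2 ht.1), EReal.coe_le_coe_iff.2 ht.2⟩, hx⟩

theorem maxSeminorm_lt_top [LocallyConvexSpace ℝ F] [T2Space F] {hab : a < b} (haτ : a < τ)
    {f : (P.slab a b hab).inner → F} (hf : IsCkExt k (P.slab a b hab) f)
    {p : Seminorm ℝ F} (hp : Continuous p) {x : E} (hx : x ∈ P.outer)
    {B : Set (ℝ × E)} (hB : Bornology.IsVonNBounded ℝ B) {d : ℕ} (hd : (d : ℕ∞) ≤ k) :
    maxSeminorm p _ f (Icc τ b ×ˢ {x}) B d < ⊤ := by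
  rw [maxSeminorm, ← Finset.sup_eq_iSup, Finset.sup_lt_iff ENNReal.zero_lt_top]
  intro ℓ hℓ
  have hℓd : ℓ ≤ d := Nat.lt_succ_iff.1 (Finset.mem_range.1 hℓ)
  obtain ⟨M, hM⟩ := hf.isJet.exists_seminorm_le hp (isCompact_Icc.prod isCompact_singleton)
    (K := Icc τ b ×ˢ {x}) (fun z hz => slab_mem_outer (x := z.2) haτ hz.1
      (by rw [show z.2 = x from hz.2]; exact hx)) hB
    (le_trans (by exact_mod_cast hℓd) hd : (ℓ : ℕ∞) ≤ k)
  refine lt_of_le_of_lt ?_ (ENNReal.ofReal_lt_top (r := M))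
  exact iSup₂_le fun z hz => iSup₂_le fun w hw => ENNReal.ofReal_le_ofReal (hM z hz w hw)

theorem ofReal_seminorm_le_maxSeminorm {H : Type*} [AddCommGroup H] [Module ℝ H]
    [TopologicalSpace H] (p : Seminorm ℝ F) (P : Omega H) (f : P.inner → F) {K B : Set H}
    {ℓ d : ℕ} (hℓ : ℓ ≤ d) {z : H} (hz : z ∈ K) {w : Fin ℓ → H} (hw : ∀ i, w i ∈ B) :
    ENNReal.ofReal (p (extDiff P f ℓ z w)) ≤ maxSeminorm p P f K B d :=
  (le_iSup₂_of_le (f := fun z (_ : z ∈ K) => ⨆ w ∈ {w : Fin ℓ → H | ∀ i, w i ∈ B},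
      ENNReal.ofReal (p (extDiff P f ℓ z w))) z hz
    (le_iSup₂ (f := fun w (_ : w ∈ {w : Fin ℓ → H | ∀ i, w i ∈ B}) =>
      ENNReal.ofReal (p (extDiff P f ℓ z w))) w hw)).trans
    (le_iSup₂ (f := fun ℓ (_ : ℓ ∈ Finset.range (d + 1)) => supSeminorm p P f K B ℓ) ℓ
      (Finset.mem_range.2 (Nat.lt_succ_of_le hℓ)))

/-- A bound on the frames `𝔅(B)` yields a bound for all directions, by multilinearity. -/
theorem IsJet.seminorm_apply_le [LocallyConvexSpace ℝ F] [T2Space F] {Q : Omega (ℝ × E)}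
    (h : IsJet k Q Φ) {m : ℕ} (hm : (m : ℕ∞) ≤ k) {z : ℝ × E} (hz : z ∈ Q.outer)
    {p : Seminorm ℝ F} {B : Set E} {N R : ℝ} (hR : 1 ≤ R)
    (hN : ∀ u : Fin m → ℝ × E, (∀ i, u i ∈ boundFrame B) → p (Φ m z u) ≤ N)
    {w : Fin m → ℝ × E} (hw : ∀ i, |(w i).1| ≤ R ∧ (w i).2 ∈ B) :
    p (Φ m z w) ≤ N * (2 * R) ^ m := by
  rw [h.apply_eq_sum hm hz w]
  have hterm : ∀ S : Finset (Fin m), p ((∏ i ∈ S, (w i).1) •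
      Φ m z (S.piecewise (fun _ => (1, 0)) fun i => (0, (w i).2))) ≤ R ^ m * N := by
    intro S
    rw [map_smul_eq_mul, Real.norm_eq_abs, Finset.abs_prod]
    refine mul_le_mul ?_ (hN _ fun i => ?_) (apply_nonneg p _) (by positivity)
    · calc ∏ i ∈ S, |(w i).1| ≤ ∏ _i ∈ S, R :=
            Finset.prod_le_prod (fun i _ => abs_nonneg _) fun i _ => (hw i).1
        _ = R ^ S.card := by rw [Finset.prod_const]
        _ ≤ R ^ m := pow_le_pow_right₀ hR (by simpa using S.card_le_univ)
    · by_cases hi : i ∈ S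
      · simp [hi, boundFrame]
      · simp [hi, boundFrame, (hw i).2]
  refine (Finset.le_sum_of_subadditive p (map_zero p).le (map_add_le_add p) _ _).trans ?_
  refine (Finset.sum_le_sum fun S _ => hterm S).trans_eq ?_
  simp only [Finset.sum_const, Finset.card_univ, Fintype.card_finset, Fintype.card_fin, nsmul_eq_mul]
  push_cast
  ring

/-- The `j`-th term of the series contributes directions with first components of size `2ʲ R`, hence
the factor `(2ʲ)^ℓ`; one factor `2 ^ ℓ` comes from the product rule, another from multilinearity. -/
theorem IsJet.seminorm_extJet_le [LocallyConvexSpace ℝ F] [T2Space F] (hc : IsSeeleyWeight c)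
    (hχ : IsCutoff τ b χ) (haτ : a < τ) {hab : a < b} (h : IsJet k (P.slab a b hab) Φ)
    {A : ℕ → ℝ} (hA : Monotone A) (hχA : ∀ n, ∀ t ≤ b, |χ n t| ≤ A n)
    {p : Seminorm ℝ F} (hp : Continuous p) {ℓ : ℕ} (hℓ : (ℓ : ℕ∞) ≤ k) {t : ℝ} (ht : b < t)
    {x : E} (hx : x ∈ P.outer) {B : Set E} {N R : ℝ} (hN0 : 0 ≤ N) (hR : 1 ≤ R)
    (hN : ∀ m ≤ ℓ, ∀ s ∈ Icc τ b, ∀ u : Fin m → ℝ × E, (∀ i, u i ∈ boundFrame B) →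
      p (Φ m (s, x) u) ≤ N)
    {w : Fin ℓ → ℝ × E} (hw : ∀ i, |(w i).1| ≤ R ∧ (w i).2 ∈ B) :
    p (extJet c χ b Φ ℓ (t, x) w) ≤ 4 ^ ℓ * A ℓ * (∑' j, |c j| * (2 ^ j) ^ ℓ) * R ^ ℓ * N := by
  have hA0 : 0 ≤ A ℓ := (abs_nonneg _).trans (hχA ℓ b le_rfl)
  rw [extJet_of_lt (show b < ((t, x) : ℝ × E).1 from ht), reflJet]
  have hterm : ∀ j, p (c j • cutJet χ Φ ℓ (reflPoint b j (t, x)) fun i => reflDir j (w i))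
      ≤ 4 ^ ℓ * A ℓ * R ^ ℓ * N * (|c j| * (2 ^ j) ^ ℓ) := by
    intro j
    rw [map_smul_eq_mul, Real.norm_eq_abs]
    have h2 : (1 : ℝ) ≤ 2 ^ j := one_le_pow₀ (by norm_num)
    have hle : (reflPoint b j (t, x)).1 ≤ b := reflPoint_fst_le ht.le
    suffices hs : p (cutJet χ Φ ℓ (reflPoint b j (t, x)) fun i => reflDir j (w i))
        ≤ 2 ^ ℓ * A (0 + ℓ) * (N * (2 * (2 ^ j * R)) ^ ℓ) by
      refine (mul_le_mul_of_nonneg_left hs (abs_nonneg _)).trans_eq ?_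
      rw [zero_add, mul_pow, mul_pow, show (4 : ℝ) = 2 * 2 by norm_num, mul_pow (2 : ℝ) 2]
      ring
    rcases le_total (reflPoint b j (t, x)).1 τ with hτ | hτ
    · rw [cutJet_eq_zero hχ hτ, map_zero, zero_add]
      positivity
    · refine seminorm_leibniz_le (p := p) hA (fun n => hχA n _ hle)
        (Q := {v : ℝ × E | |v.1| ≤ 2 ^ j * R ∧ v.2 ∈ B}) (S := 2 * (2 ^ j * R)) (by positivity)
        (fun v hv => hv.1.trans (le_mul_of_one_le_left (by positivity) one_le_two)) ℓ hN0 (fun m hm u hu => ?_) 0 _ (fun i => ⟨?_, (hw i).2⟩)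
      · exact h.seminorm_apply_le (le_trans (by exact_mod_cast hm) hℓ)
          (slab_mem_outer haτ ⟨hτ, hle⟩ hx) (one_le_mul_of_one_le_of_one_le h2 hR)
          (hN m hm _ ⟨hτ, hle⟩) hu
      · simp only [reflDir]
        rw [abs_mul, abs_neg, abs_of_pos (by positivity : (0 : ℝ) < 2 ^ j)]
        exact mul_le_mul_of_nonneg_left (hw i).1 (by positivity)
  obtain ⟨M, hM⟩ := exists_reflPoint_fst_le (E := E) τ ht
  have hsum : HasSum (fun j => c j • cutJet χ Φ ℓ (reflPoint b j (t, x)) fun i => reflDir j (w i))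
      (∑' j, c j • cutJet χ Φ ℓ (reflPoint b j (t, x)) fun i => reflDir j (w i)) :=
    (summable_of_ne_finset_zero (s := Finset.range M) fun j hj => by
      rw [cutJet_eq_zero hχ (hM j (by simpa using hj) _ le_rfl), smul_zero]).hasSum
  have hb := (hc.summable ℓ).mul_left (4 ^ ℓ * A ℓ * R ^ ℓ * N)
  have hs := hb.of_nonneg_of_le (fun j => apply_nonneg p _) hterm
  refine (Seminorm.le_tsum_of_hasSum hp hsum hs).trans ((hs.tsum_le_tsum hterm hb).trans_eq ?_)
  rw [tsum_mul_left]
  ring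

/-! ### Compatibility -/

theorem extJet_congr {E' : Type u} [AddCommGroup E'] [Module ℝ E'] [TopologicalSpace E']
    [IsTopologicalAddGroup E'] [ContinuousSMul ℝ E']
    {Φ' : ∀ m : ℕ, ℝ × E' → (Fin m → ℝ × E') → F} (hχ : IsCutoff τ b χ)
    {W : Submodule ℝ E} (Υ : W →ₗ[ℝ] E') {x : E} {x' : E'} {d : ℕ}
    (h : ∀ ℓ ≤ d, ∀ t ∈ Icc τ b, ∀ w : Fin ℓ → ℝ × W,
      Φ ℓ (t, x) (fun i => ((w i).1, ((w i).2 : E))) =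
        Φ' ℓ (t, x') (fun i => ((w i).1, Υ (w i).2)))
    {t : ℝ} (ht : τ ≤ t) (w : Fin d → ℝ × W) :
    extJet c χ b Φ d (t, x) (fun i => ((w i).1, ((w i).2 : E))) =
      extJet c χ b Φ' d (t, x') (fun i => ((w i).1, Υ (w i).2)) := by
  rcases le_or_gt t b with hb | hb
  · rw [extJet_of_le (show ((t, x) : ℝ × E).1 ≤ b from hb),
      extJet_of_le (show ((t, x') : ℝ × E').1 ≤ b from hb)]
    exact h d le_rfl t ⟨ht, hb⟩ w
  · rw [extJet_of_lt (show b < ((t, x) : ℝ × E).1 from hb),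
      extJet_of_lt (show b < ((t, x') : ℝ × E').1 from hb), reflJet, reflJet]
    refine tsum_congr fun j => ?_
    congr 1
    have hle : (reflPoint b j (t, x)).1 ≤ b := reflPoint_fst_le hb.le
    rcases le_total (reflPoint b j (t, x)).1 τ with hτ | hτ
    · rw [cutJet_eq_zero hχ hτ, cutJet_eq_zero hχ (show (reflPoint b j (t, x')).1 ≤ τ from hτ)]
    · exact leibniz_congr (fun v : ℝ × W => (v.1, (v.2 : E))) (fun v => (v.1, Υ v.2))
        (fun _ => rfl) d (fun m hm w => h m hm _ ⟨hτ, hle⟩ w) 0 fun i => reflDir j (w i)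

end Estimates

/-! ### The extension operator -/

section Operator

set_option linter.unusedSectionVars false

variable {E : Type u} [AddCommGroup E] [Module ℝ E] [TopologicalSpace E]
  [IsTopologicalAddGroup E] [ContinuousSMul ℝ E]
variable {F : Type v} [AddCommGroup F] [Module ℝ F] [TopologicalSpace F]
  [IsTopologicalAddGroup F] [ContinuousSMul ℝ F] [LocallyConvexSpace ℝ F] [T2Space F]
variable {k : ℕ∞} {a : EReal} {τ b : ℝ} {χ : ℕ → ℝ → ℝ} {c : ℕ → ℝ} {P : Omega E}

/-- The function underlying the extended jet of `f`. -/
noncomputable def seeleyFun (c : ℕ → ℝ) (χ : ℕ → ℝ → ℝ) (haτ : a < τ) (hab : a < b)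
    (P : Omega E) (f : (P.slab a b hab).inner → F)
    (z : (P.slab a ⊤ (haτ.trans_le le_top)).inner) : F :=
  extJet c χ b (extDiff (P.slab a b hab) f) 0 z ![]

theorem isCkExt_seeleyFun (hc : IsSeeleyWeight c) (hχ : IsCutoff τ b χ) (haτ : a < τ)
    (hab : a < b) {f : (P.slab a b hab).inner → F} (hf : IsCkExt k (P.slab a b hab) f) :
    IsCkExt k (P.slab a ⊤ (haτ.trans_le le_top)) (seeleyFun c χ haτ hab P f) :=
  (hf.isJet.isJet_extJet hc hχ haτ hab).isCkExt fun _ => rfl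

theorem seeleyFun_smul_add (hχ : IsCutoff τ b χ) (haτ : a < τ)
    (hab : a < b) {f g : (P.slab a b hab).inner → F} (hf : IsCkExt k (P.slab a b hab) f)
    (hg : IsCkExt k (P.slab a b hab) g) (r : ℝ) :
    seeleyFun c χ haτ hab P (r • f + g)
      = r • seeleyFun c χ haτ hab P f + seeleyFun c χ haτ hab P g := by
  ext z
  simp only [seeleyFun, Pi.add_apply, Pi.smul_apply]
  have hadd : ∀ {z : ℝ × E}, z ∈ (P.slab a b hab).outer → ∀ w : Fin 0 → ℝ × E, _ := fun {z} hz w =>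
    extDiff_smul_add hf hg r (m := 0) (by simp) hz w
  rcases le_or_gt z.1.1 b with hb | hb
  · rw [extJet_of_le hb, extJet_of_le hb, extJet_of_le hb]
    exact hadd ⟨⟨z.2.1.1, EReal.coe_le_coe_iff.2 hb⟩,
      (P.slab a ⊤ (haτ.trans_le le_top)).inner_subset_outer z.2 |>.2⟩ _
  · obtain ⟨N, hN⟩ := exists_reflJet_eq_sum (E := E) (F := F) c τ hb
    have h0 : ∀ f : (P.slab a b hab).inner → F, ∀ (m : ℕ) (z : ℝ × E) (w : Fin m → ℝ × E),
        z.1 ≤ τ → cutJet χ (extDiff (P.slab a b hab) f) m z w = 0 := fun f m z w hz =>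
      cutJet_eq_zero hχ hz w
    rw [extJet_of_lt hb, extJet_of_lt hb, extJet_of_lt hb, hN (h0 _) _ le_rfl, hN (h0 _) _ le_rfl,
      hN (h0 _) _ le_rfl, Finset.smul_sum, ← Finset.sum_add_distrib]
    refine Finset.sum_congr rfl fun j _ => ?_
    rcases le_total (reflPoint b j z.1).1 τ with hτ | hτ
    · simp only [h0 _ _ _ _ hτ, smul_zero, add_zero]
    · simp only [cutJet, leibniz]
      have hmem : reflPoint b j z.1 ∈ (P.slab a b hab).outer :=
        slab_mem_outer haτ ⟨hτ, reflPoint_fst_le hb.le⟩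
          ((P.slab a ⊤ (haτ.trans_le le_top)).inner_subset_outer z.2).2
      rw [hadd hmem]
      module

/-- Seeley's extension operator, for the weights `c` and the cutoff function `χ`. -/
noncomputable def seeleyExt (k : ℕ∞) (hc : IsSeeleyWeight c) (hχ : IsCutoff τ b χ) (haτ : a < τ)
    (hab : a < b) (P : Omega E) : CkSpace k (P.slab a b hab) F →ₗ[ℝ]
      CkSpace k (P.slab a ⊤ (haτ.trans_le le_top)) F where
  toFun f := ⟨seeleyFun c χ haτ hab P f.1, isCkExt_seeleyFun hc hχ haτ hab f.2⟩
  map_add' f g := by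
    ext1
    simpa using seeleyFun_smul_add (c := c) hχ haτ hab f.2 g.2 1
  map_smul' r f := by
    ext1
    have h0 := seeleyFun_smul_add (c := c) hχ haτ hab (isCkExt_zero (F := F) k (P.slab a b hab))
      (isCkExt_zero k _) 1
    have h1 := seeleyFun_smul_add (c := c) hχ haτ hab f.2 (isCkExt_zero k _) r
    simp only [smul_zero, add_zero, one_smul, left_eq_add] at h0
    rw [h0] at h1
    simpa using h1

theorem extDiff_seeleyExt (hc : IsSeeleyWeight c) (hχ : IsCutoff τ b χ) (haτ : a < τ)
    (hab : a < b) (f : CkSpace k (P.slab a b hab) F) {ℓ : ℕ} (hℓ : (ℓ : ℕ∞) ≤ k) {t : ℝ}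
    (ht : a < (t : EReal)) {x : E} (hx : x ∈ P.outer) (w : Fin ℓ → ℝ × E) :
    extDiff _ (seeleyExt k hc hχ haτ hab P f).1 ℓ (t, x) w
      = extJet c χ b (extDiff _ f.1) ℓ (t, x) w :=
  (IsJet.isJet_extJet hc hχ haτ hab (IsCkExt.isJet f.2)).extDiff_eq (fun _ => rfl) hℓ
    ⟨⟨ht, le_top⟩, hx⟩ w

/-- The constants of the estimates for the extension operator. -/
noncomputable def seeleyConst (c A : ℕ → ℝ) (d : ℕ) : ℝ :=
  max 1 (4 ^ d * A d * ∑' j, |c j| * (2 ^ j) ^ d)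

theorem one_le_seeleyConst (c A : ℕ → ℝ) (d : ℕ) : 1 ≤ seeleyConst c A d :=
  le_max_left _ _

theorem le_seeleyConst (hc : IsSeeleyWeight c) {A : ℕ → ℝ} (hA : Monotone A) (hA0 : ∀ n, 0 ≤ A n)
    {ℓ d : ℕ} (hℓd : ℓ ≤ d) :
    4 ^ ℓ * A ℓ * (∑' j, |c j| * (2 ^ j) ^ ℓ) ≤ seeleyConst c A d := by
  refine le_trans ?_ (le_max_right _ _)
  have h2 : ∑' j, |c j| * (2 ^ j) ^ ℓ ≤ ∑' j, |c j| * (2 ^ j) ^ d :=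
    (hc.summable ℓ).tsum_le_tsum (fun j => mul_le_mul_of_nonneg_left
      (pow_le_pow_right₀ (one_le_pow₀ one_le_two) hℓd) (abs_nonneg _)) (hc.summable d)
  have h3 : (4 : ℝ) ^ ℓ ≤ 4 ^ d := pow_le_pow_right₀ (by norm_num) hℓd
  exact mul_le_mul (mul_le_mul h3 (hA hℓd) (hA0 ℓ) (by positivity)) h2
    (tsum_nonneg fun j => by positivity) (mul_nonneg (by positivity) (hA0 d))

theorem ofReal_seminorm_seeleyExt_le (hc : IsSeeleyWeight c) (hχ : IsCutoff τ b χ) (haτ : a < τ)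
    (hab : a < b) {A : ℕ → ℝ} (hA : Monotone A) (hχA : ∀ n, ∀ t ≤ b, |χ n t| ≤ A n)
    {p : Seminorm ℝ F} (hp : Continuous p) (f : CkSpace k (P.slab a b hab) F) {ℓ d : ℕ}
    (hℓd : ℓ ≤ d) (hd : (d : ℕ∞) ≤ k) {t : ℝ} (ht : b < t) {x : E} (hx : x ∈ P.outer)
    {B : Set (ℝ × E)} {B' : Set E}
    (hfin : maxSeminorm p (P.slab a b hab) f.1 (Icc τ b ×ˢ {x}) B d < ⊤)
    (hBB' : ∀ m ≤ ℓ, ∀ u : Fin m → ℝ × E, (∀ i, u i ∈ boundFrame B') → ∀ i, u i ∈ B)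
    {R : ℝ} (hR : 1 ≤ R) {w : Fin ℓ → ℝ × E} (hw : ∀ i, |(w i).1| ≤ R ∧ (w i).2 ∈ B') :
    ENNReal.ofReal (p (extDiff _ (seeleyExt k hc hχ haτ hab P f).1 ℓ (t, x) w)) ≤
      ENNReal.ofReal (seeleyConst c A d * R ^ ℓ) *
        maxSeminorm p (P.slab a b hab) f.1 (Icc τ b ×ˢ {x}) B d := by
  have hℓ : (ℓ : ℕ∞) ≤ k := le_trans (by exact_mod_cast hℓd) hd
  have hat : a < (t : EReal) := hab.trans (EReal.coe_lt_coe_iff.2 ht)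
  rw [extDiff_seeleyExt hc hχ haτ hab f hℓ hat hx]
  have hN : ∀ m ≤ ℓ, ∀ s ∈ Icc τ b, ∀ u : Fin m → ℝ × E, (∀ i, u i ∈ boundFrame B') →
      p (extDiff (P.slab a b hab) f.1 m (s, x) u)
        ≤ (maxSeminorm p (P.slab a b hab) f.1 (Icc τ b ×ˢ {x}) B d).toReal := by
    intro m hm s hs u hu
    have hz : ((s, x) : ℝ × E) ∈ Icc τ b ×ˢ {x} := ⟨hs, mem_singleton x⟩
    exact (ENNReal.ofReal_le_iff_le_toReal hfin.ne).1
      (ofReal_seminorm_le_maxSeminorm p _ _ (hm.trans hℓd) hz (hBB' m hm u hu))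
  generalize maxSeminorm p (P.slab a b hab) f.1 (Icc τ b ×ˢ {x}) B d = N at hfin hN ⊢
  have h1 := (IsCkExt.isJet f.2).seminorm_extJet_le hc hχ haτ hA hχA hp hℓ ht hx
    ENNReal.toReal_nonneg hR hN hw
  have hCd := le_seeleyConst hc hA (fun n => (abs_nonneg _).trans (hχA n b le_rfl)) hℓd
  have hR0 : (0 : ℝ) ≤ R ^ ℓ := pow_nonneg (by linarith) ℓ
  rw [← ENNReal.ofReal_toReal hfin.ne,
    ← ENNReal.ofReal_mul (mul_nonneg (zero_le_one.trans (one_le_seeleyConst c A d)) hR0)]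
  exact ENNReal.ofReal_le_ofReal (h1.trans (mul_le_mul_of_nonneg_right
    (mul_le_mul_of_nonneg_right hCd hR0) ENNReal.toReal_nonneg))

end Operator

theorem mainTheorem1
    {F : Type v} [AddCommGroup F] [Module ℝ F] [TopologicalSpace F] [IsTopologicalAddGroup F]
    [ContinuousSMul ℝ F] [LocallyConvexSpace ℝ F] [T2Space F]
    (k : ℕ∞) (a : EReal) (τ b : ℝ) (haτ : a < (τ : EReal)) (hτb : τ < b) :
    ∃ Ext : ∀ (E : Type u) [AddCommGroup E] [Module ℝ E] [TopologicalSpace E]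
        [IsTopologicalAddGroup E] [ContinuousSMul ℝ E] [LocallyConvexSpace ℝ E] [T2Space E]
        (P : Omega E),
        CkSpace k (P.slab a b (haτ.trans (EReal.coe_lt_coe hτb))) F →ₗ[ℝ]
          CkSpace k (P.slab a ⊤ (haτ.trans_le le_top)) F,
      -- extension property, and vanishing from `2b - τ` on
      (∀ (E : Type u) [AddCommGroup E] [Module ℝ E] [TopologicalSpace E]
        [IsTopologicalAddGroup E] [ContinuousSMul ℝ E] [LocallyConvexSpace ℝ E] [T2Space E]
        (P : Omega E) (f : CkSpace k (P.slab a b (haτ.trans (EReal.coe_lt_coe hτb))) F)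
        (ℓ : ℕ), (ℓ : ℕ∞) ≤ k →
        (∀ t ∈ halfOpenInterval a b, ∀ x ∈ P.outer, ∀ w : Fin ℓ → ℝ × E,
          extDiff _ (Ext E P f).1 ℓ (t, x) w = extDiff _ f.1 ℓ (t, x) w) ∧
        (∀ t ∈ Ici (2 * b - τ), ∀ x ∈ P.outer, ∀ w : Fin ℓ → ℝ × E,
          extDiff _ (Ext E P f).1 ℓ (t, x) w = 0)) ∧
      -- continuity estimates
      (∃ C : ℕ → ℝ, (∀ d : ℕ, (d : ℕ∞) ≤ k → 1 ≤ C d) ∧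
        ∀ (E : Type u) [AddCommGroup E] [Module ℝ E] [TopologicalSpace E]
          [IsTopologicalAddGroup E] [ContinuousSMul ℝ E] [LocallyConvexSpace ℝ E] [T2Space E]
          (P : Omega E) (t : ℝ) (_ : t ∈ Ioi b) (x : E) (_ : x ∈ P.outer)
          (p : Seminorm ℝ F) (_ : Continuous p)
          (f : CkSpace k (P.slab a b (haτ.trans (EReal.coe_lt_coe hτb))) F),
          (maxSeminorm p _ f.1 (Icc τ b ×ˢ {x}) ∅ 0 < ⊤ ∧
            ENNReal.ofReal (p (extDiff _ (Ext E P f).1 0 (t, x) ![])) ≤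
              ENNReal.ofReal (C 0) * maxSeminorm p _ f.1 (Icc τ b ×ˢ {x}) ∅ 0) ∧
          (∀ ℓ d : ℕ, 1 ≤ ℓ → ℓ ≤ d → (d : ℕ∞) ≤ k →
            ∀ B : Set E, Bornology.IsVonNBounded ℝ B →
            ∀ w : Fin ℓ → ℝ × E, (∀ i, (w i).2 ∈ B) →
              maxSeminorm p _ f.1 (Icc τ b ×ˢ {x}) (boundFrame B) d < ⊤ ∧
              ENNReal.ofReal (p (extDiff _ (Ext E P f).1 ℓ (t, x) w)) ≤
                ENNReal.ofReal (C d * (max 1 (⨆ i, |(w i).1|)) ^ ℓ) *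
                  maxSeminorm p _ f.1 (Icc τ b ×ˢ {x}) (boundFrame B) d)) ∧
      -- compatibility
      (∀ (E : Type u) [AddCommGroup E] [Module ℝ E] [TopologicalSpace E]
        [IsTopologicalAddGroup E] [ContinuousSMul ℝ E] [LocallyConvexSpace ℝ E] [T2Space E]
        (E' : Type u) [AddCommGroup E'] [Module ℝ E'] [TopologicalSpace E']
        [IsTopologicalAddGroup E'] [ContinuousSMul ℝ E'] [LocallyConvexSpace ℝ E'] [T2Space E']
        (W : Submodule ℝ E) (Υ : W →ₗ[ℝ] E') (P : Omega E) (P' : Omega E')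
        (f : CkSpace k (P.slab a b (haτ.trans (EReal.coe_lt_coe hτb))) F)
        (f' : CkSpace k (P'.slab a b (haτ.trans (EReal.coe_lt_coe hτb))) F)
        (x : E) (_ : x ∈ P.outer) (x' : E') (_ : x' ∈ P'.outer) (d : ℕ) (_ : (d : ℕ∞) ≤ k),
        (∀ ℓ ≤ d, ∀ t ∈ Icc τ b, ∀ w : Fin ℓ → ℝ × W,
          extDiff _ f.1 ℓ (t, x) (fun i => ((w i).1, ((w i).2 : E))) =
            extDiff _ f'.1 ℓ (t, x') (fun i => ((w i).1, Υ (w i).2))) →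
        ∀ t ∈ Ici τ, ∀ w : Fin d → ℝ × W,
          extDiff _ (Ext E P f).1 d (t, x) (fun i => ((w i).1, ((w i).2 : E))) =
            extDiff _ (Ext E' P' f').1 d (t, x') (fun i => ((w i).1, Υ (w i).2))) := by
  have hab : a < (b : EReal) := haτ.trans (EReal.coe_lt_coe hτb)
  obtain ⟨c, hc⟩ := exists_isSeeleyWeight
  obtain ⟨χ, hχ⟩ := exists_isCutoff hτb
  obtain ⟨A, hA, hχA⟩ := hχ.exists_bound
  refine ⟨fun E _ _ _ _ _ _ _ P => seeleyExt k hc hχ haτ hab P, ?_, ?_, ?_⟩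
  · intro E _ _ _ _ _ _ _ P f ℓ hℓ
    refine ⟨fun t ht x hx w => ?_, fun t ht x hx w => ?_⟩
    · rw [extDiff_seeleyExt hc hχ haτ hab f hℓ ht.1 hx]
      exact extJet_of_le (EReal.coe_le_coe_iff.1 ht.2) w
    · have ht' : 2 * b - τ ≤ t := ht
      have hat : a < (t : EReal) := hab.trans (EReal.coe_lt_coe_iff.2 (by linarith))
      rw [extDiff_seeleyExt hc hχ haτ hab f hℓ hat hx]
      exact extJet_eq_zero hχ hτb ht' w
  · refine ⟨seeleyConst c A, fun d _ => one_le_seeleyConst c A d, ?_⟩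
    intro E _ _ _ _ _ _ _ P t ht x hx p hp f
    refine ⟨?_, fun ℓ d hℓ hℓd hd B hB w hw => ?_⟩
    · have hfin := maxSeminorm_lt_top (k := k) haτ f.2 hp hx
        (Bornology.isVonNBounded_empty ℝ (ℝ × E)) (d := 0) (by simp)
      refine ⟨hfin, ?_⟩
      -- for `ℓ = 0` there are no directions, so that every set of frames will do
      have h1 := ofReal_seminorm_seeleyExt_le hc hχ haτ hab hA hχA hp f (ℓ := 0) le_rfl (by simp)
        ht hx (B' := ∅) hfin (fun m hm u _ i => by obtain rfl := Nat.le_zero.1 hm; exact i.elim0)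
        le_rfl (w := ![]) (fun i => i.elim0)
      simpa using h1
    · have hfin := maxSeminorm_lt_top (k := k) haτ f.2 hp hx (isVonNBounded_boundFrame hB) hd
      refine ⟨hfin, ofReal_seminorm_seeleyExt_le hc hχ haτ hab hA hχA hp f hℓd hd ht hx hfin
        (fun m _ u hu => hu) (le_max_left _ _) fun i => ⟨?_, hw i⟩⟩
      exact (le_ciSup (f := fun i => |(w i).1|) (Set.finite_range _).bddAbove i).trans
        (le_max_right _ _)
  · intro E _ _ _ _ _ _ _ E' _ _ _ _ _ _ _ W Υ P P' f f' x hx x' hx' d hd h t ht w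
    have hat : a < (t : EReal) := haτ.trans_le (EReal.coe_le_coe_iff.2 ht)
    rw [extDiff_seeleyExt hc hχ haτ hab f hd hat hx, extDiff_seeleyExt hc hχ haτ hab f' hd hat hx']
    exact extJet_congr hχ Υ h ht w
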